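/- **Theorem 2 ($L_2$ convergence).** Let $(Y_1,W_1),(Y_2,W_2),\dots$ be i.i.d. copies of $(Y,W)\in\mathbb R\times\mathcal W$, $\mathcal W\subseteq\mathbb R^d$, with ${\mathrm E}[Y^2]<\infty$, let $F_W$ be the law of $W$, and let $\psi(w)={\mathrm E}[Y\mid W=w]$ (any measurable version). For each $K\ge1$ let $p_K=(p_{1K},\dots,p_{KK})^\top$ be a vector of measurable basis functions, and let $K=K_n\ge1$ be a sequence of integers such that $Q:={\mathrm E}[p_K(W)p_K(W)^\top]$ exists and $\lambda_K:=\lambda_{\min}(Q)>0$ for every $n$. For each $n$ let $\hat W_1,\dots,\hat W_n$ (which may depend on $n$) be $\mathcal W$-valued generated covariates that are measurable with respect to a sigma field $\mathcal F_n$, such that, almost surely, ${\mathrm E}[(Y_i-\psi(W_i))^2\mid\mathcal F_n]\le C$ for all $n$ and all $i\le n$, with a constant $C$ that does not depend on $n$ or $i$, and ${\mathrm E}[(Y_i-\psi(W_i))(Y_j-\psi(W_j))\mid\mathcal F_n]=0$ for all $n$ and all $i\ne j$ in $\{1,\dots,n\}$. Let $\hat\psi_K(w)=p_K(w)^\top\hat\beta_K$,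 where $\hat\beta_K$ is any minimizer over $b\in\mathbb R^K$ of $\frac1n\sum_{i=1}^n(Y_i-p_K(\hat W_i)^\top b)^2$, and $\psi_K(w)=p_K(w)^\top\beta_K$, where $\beta_K$ minimizes ${\mathrm E}[(Y-p_K(W)^\top b)^2]$ over $b\in\mathbb R^K$. The functions $\psi$ and $\psi_K$ need not be close to each other (misspecification is allowed), and $\lambda_K\to0$ is allowed. Write $\Vert g\Vert_{L^2}^2=\int|g|^2\,{\mathrm d}F_W$, $$\zeta_{0,K}=\sup_{w\in\mathcal W}\Vert p_K(w)\Vert,\qquad \xi_K^2={\mathrm E}[(\psi(W)-\psi_K(W))^2],\qquad \vartheta_{0,K}=\sup_{w\in\mathcal W}|\psi(w)-\psi_K(w)|$$ (suprema may be $+\infty$, with $0\cdot\infty=0$), and $$R_n=\frac1n\sum_{i=1}^n(\psi(W_i)-\psi(\hat W_i))^2,\qquad B_n=\frac1n\big\Vert(P-P_n)Q^{-1/2}\big\Vert_2^2,$$ where $P$ and $P_n$ are the $n\times K$ matrices with rows $p_K(W_i)^\top$ and $p_K(\hat W_i)^\top$, and $\Vert\cdot\Vert_2$ is the spectral norm.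 If $\lambda_K^{-1}\zeta_{0,K}^2\log(K)/n\to0$ and $B_n\to0$ in probability as $n\to\infty$, then $$\Vert\hat\psi_K-\psi_K\Vert_{L^2}^2=O_{\mathrm P}\Big(\frac Kn+\mathsf A_n\Big)$$ both with $$\mathsf A_n=\min\big\{B_n+\xi_K^2,\;R_n+\vartheta_{0,K}^2\big\}$$ and with $$\mathsf A_n=B_n+B_n\min\big\{B_n+\xi_K^2,\;R_n+\vartheta_{0,K}^2\big\}+\min\big\{\lambda_K^{-1}\zeta_{0,K}^2\xi_K^2/n,\;K\vartheta_{0,K}^2/n\big\}.$$ Here, for random $X_n,A_n\ge0$, $X_n=O_{\mathrm P}(A_n)$ means that for every $\varepsilon>0$ there is $M<\infty$ with ${\mathrm P}(X_n>MA_n)\le\varepsilon$ for all large $n$. -/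

import Mathlib

open MeasureTheory ProbabilityTheory Filter Topology
open scoped ENNReal NNReal

noncomputable section

namespace SeriesLS

/-- The smallest eigenvalue of a real symmetric matrix. -/
def lambdaMin {K : ℕ} (A : Matrix (Fin K) (Fin K) ℝ) : ℝ := sInf (spectrum ℝ A)

/-- `A ^ (-1/2)` for a symmetric positive definite matrix `A`, by the functional calculus. -/
def invSqrt {K : ℕ} (A : Matrix (Fin K) (Fin K) ℝ) : Matrix (Fin K) (Fin K) ℝ :=
  cfc (fun x : ℝ => (Real.sqrt x)⁻¹) A

/-- The spectral norm of a rectangular matrix: its operator norm between Euclidean spaces. -/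
def spectralNorm {n K : ℕ} (A : Matrix (Fin n) (Fin K) ℝ) : ℝ :=
  ‖LinearMap.toContinuousLinearMap (Matrix.toEuclideanLin A)‖

section Population

variable {d K : ℕ}

/-- The Gram matrix `Q = E[p_K(W) p_K(W)ᵀ]`, where `W` has law `F`. -/
def gram (F : Measure (EuclideanSpace ℝ (Fin d)))
    (q : EuclideanSpace ℝ (Fin d) → EuclideanSpace ℝ (Fin K)) : Matrix (Fin K) (Fin K) ℝ :=
  Matrix.of fun j k => ∫ w, q w j * q w k ∂F

/-- The linear combination `w ↦ p_K(w)ᵀ b` of the basis functions. -/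
def lin (q : EuclideanSpace ℝ (Fin d) → EuclideanSpace ℝ (Fin K))
    (b : EuclideanSpace ℝ (Fin K)) (w : EuclideanSpace ℝ (Fin d)) : ℝ :=
  ∑ k, q w k * b k

/-- The squared `L²` norm `∫ |g|² dF`. -/
def sqL2 (F : Measure (EuclideanSpace ℝ (Fin d))) (g : EuclideanSpace ℝ (Fin d) → ℝ) : ℝ≥0∞ :=
  ∫⁻ w, ‖g w‖ₑ ^ 2 ∂F

/-- `ζ_{0,K} = sup_{w ∈ S} ‖p_K(w)‖` (Euclidean norm). -/
def zetaZero (S : Set (EuclideanSpace ℝ (Fin d)))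
    (q : EuclideanSpace ℝ (Fin d) → EuclideanSpace ℝ (Fin K)) : ℝ≥0∞ :=
  ⨆ w ∈ S, ‖q w‖ₑ

/-- The supremum norm `sup_{w ∈ S} |g(w)|`. -/
def supNorm (S : Set (EuclideanSpace ℝ (Fin d))) (g : EuclideanSpace ℝ (Fin d) → ℝ) : ℝ≥0∞ :=
  ⨆ w ∈ S, ‖g w‖ₑ

end Population

section Sample

variable {d K n : ℕ}

/-- The `n × K` matrix with rows `p_K(x_1)ᵀ, …, p_K(x_n)ᵀ`. -/
def design (q : EuclideanSpace ℝ (Fin d) → EuclideanSpace ℝ (Fin K))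
    (x : Fin n → EuclideanSpace ℝ (Fin d)) : Matrix (Fin n) (Fin K) ℝ :=
  Matrix.of fun i k => q (x i) k

/-- The least squares criterion `n⁻¹ ∑ᵢ (yᵢ - p_K(xᵢ)ᵀ b)²`. -/
def lsLoss (q : EuclideanSpace ℝ (Fin d) → EuclideanSpace ℝ (Fin K))
    (y : Fin n → ℝ) (x : Fin n → EuclideanSpace ℝ (Fin d)) (b : EuclideanSpace ℝ (Fin K)) : ℝ :=
  (1 / (n : ℝ)) * ∑ i, (y i - lin q b (x i)) ^ 2

/-- `R_n = ‖Ψ - Ψ_n‖² / n`, with `w` the sample of covariates, `x` the generated ones. -/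
def Rn (ψ : EuclideanSpace ℝ (Fin d) → ℝ) (w x : Fin n → EuclideanSpace ℝ (Fin d)) : ℝ :=
  (∑ i, (ψ (w i) - ψ (x i)) ^ 2) / n

/-- `B_n = ‖(P - P_n) Q^{-1/2}‖₂² / n`, with `w` the sample of covariates, `x` the generated
ones. -/
def Bn (F : Measure (EuclideanSpace ℝ (Fin d)))
    (q : EuclideanSpace ℝ (Fin d) → EuclideanSpace ℝ (Fin K))
    (w x : Fin n → EuclideanSpace ℝ (Fin d)) : ℝ :=
  spectralNorm ((design q w - design q x) * invSqrt (gram F q)) ^ 2 / n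

end Sample

/-- `X_n = O_P(A_n)` for nonnegative, possibly infinite, random `X_n` and `A_n`. -/
def IsBigOP {Ω : Type*} [MeasurableSpace Ω] (μ : Measure Ω) (X A : ℕ → Ω → ℝ≥0∞) : Prop :=
  ∀ ε : ℝ≥0∞, 0 < ε → ∃ M : ℝ≥0, ∀ᶠ n in atTop, μ {ω | (M : ℝ≥0∞) * A n ω < X n ω} ≤ ε

end SeriesLS

end

/-!
The basis is whitened: `z(w) = Q^{-1/2} p_K(w)` satisfies `E[z(W) z(W)ᵀ] = I`, has squared length at
most `λ_K⁻¹ ζ²`, and turns the `L²` distance of `p_Kᵀ b` and `p_Kᵀ c` into the Euclidean distance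
of the coefficients `Q^{1/2} b` and `Q^{1/2} c` (`SeriesLS.sqL2_lin_sub_lin`).

The sample Gram matrix of `z(W₁), …, z(W_n)` has all its eigenvalues above `1 / 2` with probability
tending to one (`SeriesLS.tendsto_measure_lowGram`). For `K ≥ 2` this is a matrix Chernoff bound,
`measureReal_exists_sum_dotProduct_sq_lt_le`. Its potential is `E tr exp(-θ ∑ᵢ z(Wᵢ) z(Wᵢ)ᵀ)`: by the
Golden–Thompson inequality `Matrix.trace_exp_add_le`, every further observation multiplies it by at
most `exp(-c)`. Golden–Thompson in turn follows from the Lie product formula and the inequality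
`tr (X Y) ^ m ≤ tr (X ^ m Y ^ m)` for `m` a power of two. For `K = 1` the rate condition is void and
the law of large numbers takes the place of the Chernoff bound. Since `B_n → 0`, the Gram matrix of
the generated design inherits a lower bound on its eigenvalues.

On this event the normal equations bound the error by three terms
(`norm_sq_le_of_normal_eq`, `norm_sq_le_of_normal_eq'`).
* The noise `∑ᵢ Uᵢ z(Ŵᵢ)` with `Uᵢ = Yᵢ - ψ(Wᵢ)` gives `K / n`. Conditionally on `ℱ_n` its second
  moment is at most `C ∑ᵢ ‖z(Ŵᵢ)‖²`, and this sum is of order `n K`; the argument truncates on an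
  `ℱ_n`-measurable event (`setLIntegral_enorm_sum_smul_sq_le`).
* The difference `(P - P_n) β` of the two designs gives `B_n`, as `‖Q^{1/2} β‖² ≤ E[Y²]`.
* The approximation errors `e(Wᵢ) = ψ(Wᵢ) - ψ_K(Wᵢ)` have mean square of order `ξ²`, and at most
  `ϑ²`. Bounding them by their length gives the first rate. For the second one, only
  `∑ᵢ e(Wᵢ) z(Wᵢ)` and a multiple of `B_n` are kept; the former is centred by the population normal
  equations, so that its second moment is `n E[e(W)² ‖z(W)‖²]`
  (`lintegral_enorm_sum_smul_sq_le`).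
-/

/-! ### The Golden–Thompson inequality -/

namespace Matrix

variable {κ : Type*} [Fintype κ]

/-- The Cauchy–Schwarz inequality for the trace inner product. -/
lemma trace_mul_sq_le (A B : Matrix κ κ ℝ) :
    (A * B).trace ^ 2 ≤ (A * Aᵀ).trace * (Bᵀ * B).trace := by
  have hA : (A * Aᵀ).trace = ∑ x : κ × κ, A x.1 x.2 ^ 2 := by
    simp [trace, mul_apply, Fintype.sum_prod_type, sq]
  have hB : (Bᵀ * B).trace = ∑ x : κ × κ, B x.2 x.1 ^ 2 := by
    simp [trace, mul_apply, Fintype.sum_prod_type, sq]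
  have hAB : (A * B).trace = ∑ x : κ × κ, A x.1 x.2 * B x.2 x.1 := by
    simp [trace, mul_apply, Fintype.sum_prod_type]
  rw [hA, hB, hAB]
  exact Finset.sum_mul_sq_le_sq_mul_sq _ _ _

lemma trace_mul_transpose_nonneg (A : Matrix κ κ ℝ) : 0 ≤ (A * Aᵀ).trace := by
  simpa [trace, mul_apply] using
    Finset.sum_nonneg fun i _ => Finset.sum_nonneg fun j _ => mul_self_nonneg (A i j)

variable [DecidableEq κ]

lemma mul_pow_succ_cycle (A B : Matrix κ κ ℝ) (m : ℕ) :
    (A * B) ^ m * A = A * (B * A) ^ m := by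
  induction m with
  | zero => simp
  | succ m ih => rw [pow_succ', pow_succ', mul_assoc, ih]; simp only [mul_assoc]

/-- The trace of a power of a product is invariant under cyclic rotation of the factors. -/
lemma trace_mul_pow_comm (A B : Matrix κ κ ℝ) (m : ℕ) :
    ((A * B) ^ m).trace = ((B * A) ^ m).trace := by
  cases m with
  | zero => simp
  | succ m =>
    rw [pow_succ, ← mul_assoc, mul_pow_succ_cycle, mul_assoc, trace_mul_comm, mul_assoc, ← pow_succ]

/-- Weyl's trace inequality `|tr M ^ (2m)| ≤ tr (M Mᵀ) ^ m` and the Lieb–Thirring inequality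
`tr (X Y) ^ m ≤ tr (X ^ m Y ^ m)` for symmetric `X`, `Y`, both for `m = 2 ^ j`. They are proved
together, since each induction step uses both. -/
lemma trace_pow_two_pow_le (j : ℕ) :
    (∀ M : Matrix κ κ ℝ, |(M ^ 2 ^ (j + 1)).trace| ≤ ((M * Mᵀ) ^ 2 ^ j).trace) ∧
    (∀ X Y : Matrix κ κ ℝ, Xᵀ = X → Yᵀ = Y →
      ((X * Y) ^ 2 ^ j).trace ≤ (X ^ 2 ^ j * Y ^ 2 ^ j).trace) := by
  induction j with
  | zero =>
    refine ⟨fun M => ?_, fun X Y _ _ => by simp⟩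
    have h := trace_mul_sq_le M M
    rw [trace_mul_comm Mᵀ, ← sq (M * Mᵀ).trace] at h
    simpa [sq] using abs_le_of_sq_le_sq h (trace_mul_transpose_nonneg M)
  | succ j ih =>
    obtain ⟨hP, hQ⟩ := ih
    have hQ' : ∀ X Y : Matrix κ κ ℝ, Xᵀ = X → Yᵀ = Y →
        ((X * Y) ^ 2 ^ (j + 1)).trace ≤ (X ^ 2 ^ (j + 1) * Y ^ 2 ^ (j + 1)).trace := by
      intro X Y hX hY
      have h1 := (le_abs_self _).trans (hP (X * Y))
      have h3 : X * Y * (X * Y)ᵀ = X * (Y ^ 2 * X) := by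
        rw [transpose_mul, hX, hY, sq]; simp only [mul_assoc]
      rw [h3, trace_mul_pow_comm X (Y ^ 2 * X), mul_assoc, ← sq, trace_mul_pow_comm (Y ^ 2)] at h1
      have h2 := hQ (X ^ 2) (Y ^ 2) (by rw [transpose_pow, hX]) (by rw [transpose_pow, hY])
      rw [← pow_mul, ← pow_mul, ← pow_succ'] at h2
      exact h1.trans h2
    refine ⟨fun M => ?_, hQ'⟩
    have hV : (M * Mᵀ)ᵀ = M * Mᵀ := by simp
    have hU : (Mᵀ * M)ᵀ = Mᵀ * M := by simp
    have h1 := hP (M ^ 2)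
    have h2 := hQ (Mᵀ * M) (M * Mᵀ) hU hV
    have h3 : M ^ 2 * (M ^ 2)ᵀ = M * (M * Mᵀ * Mᵀ) := by
      rw [sq, transpose_mul]; simp only [mul_assoc]
    have h4 : (M * Mᵀ * Mᵀ) * M = (M * Mᵀ) * (Mᵀ * M) := by simp only [mul_assoc]
    rw [← pow_mul, ← pow_succ', h3, trace_mul_pow_comm, h4, trace_mul_pow_comm] at h1
    refine h1.trans (h2.trans (le_of_sq_le_sq ?_ ?_))
    · have h5 := trace_mul_sq_le ((Mᵀ * M) ^ 2 ^ j) ((M * Mᵀ) ^ 2 ^ j)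
      rw [transpose_pow, transpose_pow, hV, hU, ← pow_add, ← pow_add, ← two_mul, ← pow_succ',
        trace_mul_pow_comm Mᵀ M, ← sq (trace _)] at h5
      exact h5
    · have h6 := trace_mul_transpose_nonneg ((M * Mᵀ) ^ 2 ^ j)
      rwa [transpose_pow, hV, ← pow_add, ← two_mul, ← pow_succ'] at h6

end Matrix

section LieProduct

variable {𝔸 : Type*} [NormedRing 𝔸] [NormOneClass 𝔸]

lemma norm_pow_sub_pow_le (x y : 𝔸) {c : ℝ} (hx : ‖x‖ ≤ c) (hy : ‖y‖ ≤ c) (m : ℕ) :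
    ‖x ^ m - y ^ m‖ ≤ m * c ^ (m - 1) * ‖x - y‖ := by
  have hc : 0 ≤ c := (norm_nonneg x).trans hx
  induction m with
  | zero => simp
  | succ m ih =>
    have h : x ^ (m + 1) - y ^ (m + 1) = x ^ m * (x - y) + (x ^ m - y ^ m) * y := by
      rw [pow_succ, pow_succ]; noncomm_ring
    have h1 : ‖x ^ m * (x - y)‖ ≤ c ^ m * ‖x - y‖ :=
      (norm_mul_le _ _).trans <| mul_le_mul_of_nonneg_right
        ((norm_pow_le _ _).trans (pow_le_pow_left₀ (norm_nonneg _) hx m)) (norm_nonneg _)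
    have h2 : ‖(x ^ m - y ^ m) * y‖ ≤ m * c ^ m * ‖x - y‖ := by
      refine (norm_mul_le _ _).trans ((mul_le_mul ih hy (norm_nonneg _) (by positivity)).trans ?_)
      rcases m with _ | m
      · simp
      · simp only [Nat.add_sub_cancel, pow_succ]; apply le_of_eq; ring
    rw [h]
    refine (norm_add_le _ _).trans ((add_le_add h1 h2).trans (le_of_eq ?_))
    push_cast [Nat.add_sub_cancel]
    ring

variable [NormedAlgebra ℝ 𝔸] [CompleteSpace 𝔸]

/-- The Lie product formula. -/
lemma tendsto_exp_mul_exp_pow (a b : 𝔸) :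
    Tendsto (fun m : ℕ => (NormedSpace.exp ((m : ℝ)⁻¹ • a) * NormedSpace.exp ((m : ℝ)⁻¹ • b)) ^ m)
      atTop (𝓝 (NormedSpace.exp (a + b))) := by
  have hnorm : ∀ x : 𝔸, ‖NormedSpace.exp x‖ ≤ Real.exp ‖x‖ := fun x => by
    have h := NormedSpace.exp_series_hasSum_exp' (𝕂 := ℝ) ‖x‖
    rw [← Real.exp_eq_exp_ℝ] at h
    rw [NormedSpace.exp_eq_tsum ℝ]
    refine tsum_of_norm_bounded h fun n => ?_
    rw [norm_smul, Real.norm_of_nonneg (by positivity), smul_eq_mul]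
    gcongr
    exact norm_pow_le x n
  -- both factors have the same derivative at `0`
  have hd : HasDerivAt (fun t : ℝ => NormedSpace.exp (t • a) * NormedSpace.exp (t • b)
      - NormedSpace.exp (t • (a + b))) 0 0 := by
    have h1 : ∀ x : 𝔸, HasDerivAt (fun t : ℝ => NormedSpace.exp (t • x)) x 0 := fun x => by
      simpa using hasDerivAt_exp_smul_const (𝕂 := ℝ) x (0 : ℝ)
    have h2 := ((h1 a).mul (h1 b)).sub (h1 (a + b))
    simp only [zero_smul, NormedSpace.exp_zero, mul_one, one_mul, sub_self] at h2
    exact h2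
  have hlim : Tendsto (fun m : ℕ => ‖(m : ℝ) • (NormedSpace.exp ((m : ℝ)⁻¹ • a) *
      NormedSpace.exp ((m : ℝ)⁻¹ • b) - NormedSpace.exp ((m : ℝ)⁻¹ • (a + b)))‖) atTop (𝓝 0) := by
    have h := (hasDerivAt_iff_tendsto_slope_zero.1 hd).comp
      (tendsto_nhdsWithin_iff.2 ⟨tendsto_inv_atTop_nhds_zero_nat (𝕜 := ℝ),
        (eventually_gt_atTop 0).mono fun m hm => by simp; omega⟩)
    simpa using h.norm
  have hbound : ∀ m : ℕ, 0 < m → ‖(NormedSpace.exp ((m : ℝ)⁻¹ • a) *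
      NormedSpace.exp ((m : ℝ)⁻¹ • b)) ^ m - NormedSpace.exp (a + b)‖ ≤
      Real.exp (‖a‖ + ‖b‖) * ‖(m : ℝ) • (NormedSpace.exp ((m : ℝ)⁻¹ • a) *
      NormedSpace.exp ((m : ℝ)⁻¹ • b) - NormedSpace.exp ((m : ℝ)⁻¹ • (a + b)))‖ := by
    intro m hm
    have hm' : (0 : ℝ) < m := by exact_mod_cast hm
    let : NormedAlgebra ℚ 𝔸 := NormedAlgebra.restrictScalars ℚ ℝ 𝔸
    have he : NormedSpace.exp (a + b) = NormedSpace.exp ((m : ℝ)⁻¹ • (a + b)) ^ m := by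
      rw [← NormedSpace.exp_nsmul, ← Nat.cast_smul_eq_nsmul ℝ, smul_smul, mul_inv_cancel₀ hm'.ne',
        one_smul]
    set c := Real.exp ((m : ℝ)⁻¹ * (‖a‖ + ‖b‖)) with hc
    have hx : ‖NormedSpace.exp ((m : ℝ)⁻¹ • a) * NormedSpace.exp ((m : ℝ)⁻¹ • b)‖ ≤ c := by
      refine (norm_mul_le _ _).trans ?_
      rw [hc, mul_add, Real.exp_add]
      refine mul_le_mul ((hnorm _).trans ?_) ((hnorm _).trans ?_) (norm_nonneg _) (Real.exp_nonneg _)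
        <;> simp [norm_smul]
    have hy : ‖NormedSpace.exp ((m : ℝ)⁻¹ • (a + b))‖ ≤ c := by
      refine (hnorm _).trans ?_
      rw [hc, norm_smul, Real.norm_of_nonneg (by positivity)]
      gcongr
      exact norm_add_le _ _
    have hc1 : 1 ≤ c := Real.one_le_exp (by positivity)
    have hcm : c ^ m = Real.exp (‖a‖ + ‖b‖) := by
      rw [hc, ← Real.exp_nat_mul]; congr 1; field_simp
    rw [he]
    refine (norm_pow_sub_pow_le _ _ hx hy m).trans ?_
    rw [norm_smul, Real.norm_of_nonneg hm'.le, ← hcm, mul_comm (m : ℝ), mul_assoc]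
    exact mul_le_mul_of_nonneg_right (pow_le_pow_right₀ hc1 (Nat.sub_le _ _)) (by positivity)
  rw [tendsto_iff_norm_sub_tendsto_zero]
  refine squeeze_zero' (.of_forall fun _ => norm_nonneg _)
    ((eventually_gt_atTop 0).mono fun m hm => hbound m hm) ?_
  simpa using hlim.const_mul (Real.exp (‖a‖ + ‖b‖))

end LieProduct

namespace Matrix

variable {κ : Type*} [Fintype κ] [DecidableEq κ]

open scoped Norms.Operator in
/-- The **Golden–Thompson inequality** for real symmetric matrices. -/
theorem trace_exp_add_le [Nonempty κ] {A B : Matrix κ κ ℝ} (hA : Aᵀ = A) (hB : Bᵀ = B) :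
    (NormedSpace.exp (A + B)).trace ≤ (NormedSpace.exp A * NormedSpace.exp B).trace := by
  have hlim : Tendsto (fun j : ℕ => ((NormedSpace.exp (((2 ^ j : ℕ) : ℝ)⁻¹ • A) *
      NormedSpace.exp (((2 ^ j : ℕ) : ℝ)⁻¹ • B)) ^ 2 ^ j).trace) atTop
      (𝓝 (NormedSpace.exp (A + B)).trace) := by
    have hc : Continuous fun X : Matrix κ κ ℝ => X.trace := continuous_id.matrix_trace
    exact (hc.tendsto _).comp ((tendsto_exp_mul_exp_pow A B).comp
      (tendsto_pow_atTop_atTop_of_one_lt (r := 2) one_lt_two))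
  refine le_of_tendsto' hlim fun j => ?_
  have hsymm : ∀ (X : Matrix κ κ ℝ) (t : ℝ), Xᵀ = X →
      (NormedSpace.exp (t • X))ᵀ = NormedSpace.exp (t • X) := fun X t hX => by
    rw [← exp_transpose, transpose_smul, hX]
  have hpow : ∀ X : Matrix κ κ ℝ,
      NormedSpace.exp (((2 ^ j : ℕ) : ℝ)⁻¹ • X) ^ 2 ^ j = NormedSpace.exp X := fun X => by
    rw [← exp_nsmul, ← Nat.cast_smul_eq_nsmul ℝ, smul_smul, mul_inv_cancel₀ (by positivity),
      one_smul]
  refine ((trace_pow_two_pow_le j).2 _ _ (hsymm A _ hA) (hsymm B _ hB)).trans ?_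
  rw [hpow, hpow]

end Matrix

/-! ### A matrix Chernoff bound for the smallest eigenvalue -/

namespace Matrix

variable {κ : Type*} [Fintype κ] [DecidableEq κ]

lemma vecMulVec_self_pow_succ (x : κ → ℝ) (m : ℕ) :
    vecMulVec x x ^ (m + 1) = (x ⬝ᵥ x) ^ m • vecMulVec x x := by
  induction m with
  | zero => simp
  | succ m ih =>
    rw [pow_succ, ih, smul_mul_assoc, vecMulVec_mul_vecMulVec, pow_succ, mul_smul]
    simp

open scoped Norms.Operator in
/-- The exponential of a rank one matrix, multiplied by `x ⬝ᵥ x` to avoid a division. -/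
lemma exp_smul_vecMulVec_self (t : ℝ) (x : κ → ℝ) :
    (x ⬝ᵥ x) • (NormedSpace.exp (t • vecMulVec x x) - 1) =
      (Real.exp (t * (x ⬝ᵥ x)) - 1) • vecMulVec x x := by
  have h1 := NormedSpace.exp_series_hasSum_exp' (𝕂 := ℝ) (t • vecMulVec x x)
  have h2 := NormedSpace.exp_series_hasSum_exp' (𝕂 := ℝ) (t * (x ⬝ᵥ x))
  rw [← Real.exp_eq_exp_ℝ] at h2
  rw [← hasSum_nat_add_iff' 1] at h1 h2
  have h3 := h2.smul_const (vecMulVec x x)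
  have h4 := h1.const_smul (x ⬝ᵥ x)
  simp only [Finset.range_one, Finset.sum_singleton, Nat.factorial_zero, Nat.cast_one, inv_one,
    pow_zero, one_smul, smul_eq_mul, mul_one] at h3 h4
  have h5 : ∀ m : ℕ, (x ⬝ᵥ x) • (((m + 1).factorial : ℝ)⁻¹ • (t • vecMulVec x x) ^ (m + 1)) =
      (((m + 1).factorial : ℝ)⁻¹ * (t * (x ⬝ᵥ x)) ^ (m + 1)) • vecMulVec x x := fun m => by
    rw [smul_pow, vecMulVec_self_pow_succ, smul_smul, smul_smul, smul_smul]
    congr 1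
    ring
  simp only [h5] at h4
  exact h4.unique h3

lemma exp_transpose_of_symm {X : Matrix κ κ ℝ} (t : ℝ) (hX : Xᵀ = X) :
    (NormedSpace.exp (t • X))ᵀ = NormedSpace.exp (t • X) := by
  rw [← exp_transpose, transpose_smul, hX]

lemma dotProduct_exp_mulVec_nonneg {X : Matrix κ κ ℝ} (hX : Xᵀ = X) (v : κ → ℝ) :
    0 ≤ v ⬝ᵥ (NormedSpace.exp X *ᵥ v) := by
  set E := NormedSpace.exp ((2 : ℝ)⁻¹ • X)
  have hE : NormedSpace.exp X = Eᵀ * E := by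
    rw [exp_transpose_of_symm _ hX, ← exp_add_of_commute _ _ (Commute.refl _), ← add_smul]
    norm_num
  rw [hE, ← mulVec_mulVec, dotProduct_mulVec, vecMul_transpose]
  exact Finset.sum_nonneg fun i _ => mul_self_nonneg _

/-- Adding a rank one term lowers the exponential trace potential by a fraction of a quadratic
form. This is where the Golden–Thompson inequality enters. -/
lemma trace_exp_add_vecMulVec_le [Nonempty κ] {M : Matrix κ κ ℝ} (hM : Mᵀ = M) {L : ℝ} (hL : 0 < L)
    {x : κ → ℝ} (hx : x ⬝ᵥ x ≤ L) :
    (NormedSpace.exp ((-L⁻¹) • (M + vecMulVec x x))).trace ≤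
      (NormedSpace.exp ((-L⁻¹) • M)).trace -
        (1 - Real.exp (-1)) / L * (x ⬝ᵥ (NormedSpace.exp ((-L⁻¹) • M) *ᵥ x)) := by
  have hxx : (vecMulVec x x)ᵀ = vecMulVec x x := by rw [transpose_vecMulVec]
  rw [smul_add]
  refine (trace_exp_add_le (by rw [transpose_smul, hM]) (by rw [transpose_smul, hxx])).trans ?_
  have hE := exp_smul_vecMulVec_self (-L⁻¹) x
  set E := NormedSpace.exp ((-L⁻¹) • M)
  set q := x ⬝ᵥ (E *ᵥ x)
  have hq : 0 ≤ q := dotProduct_exp_mulVec_nonneg (by rw [transpose_smul, hM]) x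
  have htr : (E * vecMulVec x x).trace = q := by
    rw [mul_vecMulVec, trace_vecMulVec, dotProduct_comm]
  have hs : 0 ≤ x ⬝ᵥ x := Finset.sum_nonneg fun i _ => mul_self_nonneg _
  rcases hs.eq_or_lt with h0 | h0
  · have hx0 : x = 0 := dotProduct_self_eq_zero.1 h0.symm
    simp [q, hx0]
  · have key : (x ⬝ᵥ x) * ((E * NormedSpace.exp ((-L⁻¹) • vecMulVec x x)).trace - E.trace) =
        (Real.exp (-L⁻¹ * (x ⬝ᵥ x)) - 1) * q := by
      have h := congrArg (fun X => (E * X).trace) hE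
      simpa only [mul_smul_comm, mul_sub, mul_one, trace_smul, trace_sub, htr, smul_eq_mul] using h
    -- convexity of the exponential between `-1` and `0`
    have hconv : Real.exp (-L⁻¹ * (x ⬝ᵥ x)) ≤ 1 - (x ⬝ᵥ x) / L * (1 - Real.exp (-1)) := by
      have hu : (x ⬝ᵥ x) / L ≤ 1 := (div_le_one hL).2 hx
      have := convexOn_exp.2 (Set.mem_univ (0 : ℝ)) (Set.mem_univ (-1 : ℝ))
        (sub_nonneg.2 hu) (by positivity : 0 ≤ (x ⬝ᵥ x) / L) (by ring)
      simp only [smul_eq_mul, mul_zero, zero_add, Real.exp_zero, mul_one] at this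
      have e : x ⬝ᵥ x / L * -1 = -L⁻¹ * (x ⬝ᵥ x) := by ring
      rw [e] at this
      linarith
    have h1 : (x ⬝ᵥ x) * ((E * NormedSpace.exp ((-L⁻¹) • vecMulVec x x)).trace - E.trace) ≤
        (x ⬝ᵥ x) * (-((1 - Real.exp (-1)) / L * q)) := by
      rw [key]
      calc _ ≤ (-((x ⬝ᵥ x) / L * (1 - Real.exp (-1)))) * q :=
            mul_le_mul_of_nonneg_right (by linarith) hq
        _ = _ := by ring
    have := le_of_mul_le_mul_left h1 h0
    linarith

lemma exp_le_trace_exp {M : Matrix κ κ ℝ} (hM : Mᵀ = M) {θ t : ℝ} (hθ : 0 ≤ θ) {v : κ → ℝ}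
    (hv : v ⬝ᵥ (M *ᵥ v) < t * (v ⬝ᵥ v)) :
    Real.exp (-(θ * t)) ≤ (NormedSpace.exp ((-θ) • M)).trace := by
  have hH : M.IsHermitian := by rw [IsHermitian, conjTranspose_eq_transpose_of_trivial, hM]
  set U : Matrix κ κ ℝ := (hH.eigenvectorUnitary : Matrix κ κ ℝ)
  have hUU : Uᵀ * U = 1 := by
    simpa [star_eq_conjTranspose, conjTranspose_eq_transpose_of_trivial] using
      Unitary.coe_star_mul_self hH.eigenvectorUnitary
  have hUU' : U * Uᵀ = 1 := mul_eq_one_comm.1 hUU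
  have hMU : M = U * diagonal hH.eigenvalues * Uᵀ := by
    conv_lhs => rw [hH.spectral_theorem]
    rw [Unitary.conjStarAlgAut_apply, star_eq_conjTranspose,
      conjTranspose_eq_transpose_of_trivial]
    rfl
  have htr : (NormedSpace.exp ((-θ) • M)).trace = ∑ i, Real.exp (-θ * hH.eigenvalues i) := by
    have e : (-θ) • M = U * diagonal (fun i => -θ * hH.eigenvalues i) * U⁻¹ := by
      conv_lhs => rw [hMU]
      rw [inv_eq_right_inv hUU', ← smul_mul_assoc, ← mul_smul_comm, ← diagonal_smul]
      rfl
    rw [e, exp_conj _ _ (IsUnit.of_mul_eq_one _ hUU'), trace_mul_comm, ← mul_assoc,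
      inv_eq_right_inv hUU', hUU, one_mul, exp_diagonal, trace_diagonal]
    refine Finset.sum_congr rfl fun i _ => ?_
    rw [Pi.coe_exp, Real.exp_eq_exp_ℝ]
  -- some eigenvalue is below the Rayleigh quotient of `v`
  obtain ⟨i, hi⟩ : ∃ i, hH.eigenvalues i < t := by
    by_contra! h
    refine absurd hv (not_lt.2 ?_)
    have e1 : v ⬝ᵥ (M *ᵥ v) = ∑ i, hH.eigenvalues i * (Uᵀ *ᵥ v) i ^ 2 := by
      conv_lhs => rw [hMU]
      rw [← mulVec_mulVec, ← mulVec_mulVec, dotProduct_mulVec, ← mulVec_transpose, dotProduct]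
      refine Finset.sum_congr rfl fun i _ => ?_
      rw [mulVec_diagonal]; ring
    have e2 : v ⬝ᵥ v = ∑ i, (Uᵀ *ᵥ v) i ^ 2 := by
      have : v ⬝ᵥ v = v ⬝ᵥ (U *ᵥ (Uᵀ *ᵥ v)) := by rw [mulVec_mulVec, hUU', one_mulVec]
      rw [this, dotProduct_mulVec, ← mulVec_transpose, dotProduct]
      exact Finset.sum_congr rfl fun i _ => (sq _).symm
    rw [e1, e2, Finset.mul_sum]
    exact Finset.sum_le_sum fun i _ => mul_le_mul_of_nonneg_right (h i) (sq_nonneg _)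
  rw [htr]
  refine le_trans ?_ (Finset.single_le_sum (f := fun i => Real.exp (-θ * hH.eigenvalues i))
    (fun i _ => (Real.exp_pos _).le) (Finset.mem_univ i))
  refine Real.exp_le_exp.2 ?_
  nlinarith

end Matrix

namespace Matrix

variable {κ : Type*}

lemma transpose_sum_vecMulVec_self {ι : Type*} (s : Finset ι) (y : ι → κ → ℝ) :
    (∑ i ∈ s, vecMulVec (y i) (y i))ᵀ = ∑ i ∈ s, vecMulVec (y i) (y i) := by
  rw [transpose_sum]
  exact Finset.sum_congr rfl fun i _ => transpose_vecMulVec _ _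

variable [Fintype κ]

lemma dotProduct_sum_vecMulVec_mulVec {ι : Type*} (s : Finset ι) (y : ι → κ → ℝ) (v : κ → ℝ) :
    v ⬝ᵥ ((∑ i ∈ s, vecMulVec (y i) (y i)) *ᵥ v) = ∑ i ∈ s, (y i ⬝ᵥ v) ^ 2 := by
  rw [sum_mulVec, dotProduct_sum]
  refine Finset.sum_congr rfl fun i _ => ?_
  rw [vecMulVec_mulVec, sq]
  simp [dotProduct_comm v]

variable [DecidableEq κ]

lemma trace_exp_nonneg {X : Matrix κ κ ℝ} (hX : Xᵀ = X) : 0 ≤ (NormedSpace.exp X).trace :=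
  Finset.sum_nonneg fun i _ => by
    simpa using dotProduct_exp_mulVec_nonneg hX (Pi.single i 1)

open scoped Norms.Operator in
lemma continuous_exp : Continuous (NormedSpace.exp : Matrix κ κ ℝ → Matrix κ κ ℝ) := by
  let : NormedAlgebra ℚ (Matrix κ κ ℝ) := NormedAlgebra.restrictScalars ℚ ℝ _
  exact NormedSpace.exp_continuous

lemma continuous_exp_smul_sum_vecMulVec_apply {ι : Type*} (s : Finset ι) (t : ℝ) (j k : κ) :
    Continuous fun y : ι → κ → ℝ =>
      NormedSpace.exp (t • ∑ i ∈ s, vecMulVec (y i) (y i)) j k := by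
  have h : Continuous fun y : ι → κ → ℝ => t • ∑ i ∈ s, vecMulVec (y i) (y i) :=
    (continuous_finsetSum _ fun i _ =>
      (continuous_apply i).matrix_vecMulVec (continuous_apply i)).const_smul t
  exact (continuous_exp.comp h).matrix_elem j k

end Matrix

open Matrix in
/-- **Matrix Chernoff bound**: the probability that the second moment matrix of `n` independent
isotropic vectors of squared length at most `L` has an eigenvalue below `n / 2`. -/
theorem measureReal_exists_sum_dotProduct_sq_lt_le {Ω κ : Type*} [MeasurableSpace Ω] [Fintype κ]
    [Nonempty κ] {μ : Measure Ω} [IsProbabilityMeasure μ] {Z : ℕ → Ω → κ → ℝ}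
    (hZ : ∀ i, Measurable (Z i)) (hind : iIndepFun Z μ) [DecidableEq κ]
    (hiso : ∀ i j k, ∫ ω, Z i ω j * Z i ω k ∂μ = if j = k then 1 else 0)
    {L : ℝ} (hL : 0 < L) (hbd : ∀ i, ∀ᵐ ω ∂μ, Z i ω ⬝ᵥ Z i ω ≤ L) (n : ℕ) :
    μ.real {ω | ∃ v : κ → ℝ, ∑ i ∈ Finset.range n, (Z i ω ⬝ᵥ v) ^ 2 < n / 2 * (v ⬝ᵥ v)} ≤
      Fintype.card κ * Real.exp (-(n / (10 * L))) := by
  set M : ℕ → Ω → Matrix κ κ ℝ := fun m ω =>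
    ∑ i ∈ Finset.range m, vecMulVec (Z i ω) (Z i ω) with hMdef
  set E : ℕ → Ω → Matrix κ κ ℝ := fun m ω => NormedSpace.exp ((-L⁻¹) • M m ω) with hEdef
  have hMT : ∀ m ω, (M m ω)ᵀ = M m ω := fun m ω => transpose_sum_vecMulVec_self _ _
  have hsT : ∀ m ω, ((-L⁻¹) • M m ω)ᵀ = (-L⁻¹) • M m ω := fun m ω => by
    rw [transpose_smul, hMT]
  have hZj : ∀ i j, Measurable fun ω => Z i ω j := fun i j => (measurable_pi_apply j).comp (hZ i)
  have hZbd : ∀ i, ∀ᵐ ω ∂μ, ∀ j, |Z i ω j| ≤ √L := fun i => by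
    filter_upwards [hbd i] with ω h j
    refine Real.abs_le_sqrt (le_trans ?_ h)
    rw [sq]
    exact Finset.single_le_sum (f := fun j => Z i ω j * Z i ω j)
      (fun j _ => mul_self_nonneg _) (Finset.mem_univ j)
  -- the entries of the exponential as functions of the first `m` vectors
  have hcont := fun (m : ℕ) (j k : κ) =>
    continuous_exp_smul_sum_vecMulVec_apply (Finset.univ : Finset (Finset.range m)) (-L⁻¹) j k
  have hEeq : ∀ m ω j k, E m ω j k = NormedSpace.exp ((-L⁻¹) •
      ∑ i : Finset.range m, vecMulVec (Z i ω) (Z i ω)) j k := fun m ω j k => by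
    simp only [hEdef, hMdef]
    rw [Finset.sum_coe_sort (Finset.range m) fun i => vecMulVec (Z i ω) (Z i ω)]
  have hEmeas : ∀ m j k, Measurable fun ω => E m ω j k := fun m j k => by
    simp only [hEeq]
    exact (hcont m j k).measurable.comp
      (measurable_pi_lambda (fun ω (i : Finset.range m) => Z i ω) fun i => hZ i)
  have hEbd : ∀ m j k, ∃ C : ℝ, ∀ᵐ ω ∂μ, ‖E m ω j k‖ ≤ C := fun m j k => by
    obtain ⟨C, hC⟩ := (isCompact_closedBall (0 : Finset.range m → κ → ℝ)
      (√L)).exists_bound_of_continuousOn (hcont m j k).continuousOn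
    refine ⟨C, ?_⟩
    filter_upwards [ae_all_iff.2 hZbd] with ω h
    rw [hEeq]
    refine hC (fun i => Z i ω) ?_
    rw [mem_closedBall_zero_iff, pi_norm_le_iff_of_nonneg (Real.sqrt_nonneg _)]
    intro i
    rw [pi_norm_le_iff_of_nonneg (Real.sqrt_nonneg _)]
    exact fun j => h i j
  have hEint : ∀ m j k, Integrable (fun ω => E m ω j k) μ := fun m j k => by
    obtain ⟨C, hC⟩ := hEbd m j k
    exact Integrable.of_bound (hEmeas m j k).aestronglyMeasurable C hC
  have hZZint : ∀ i j k, Integrable (fun ω => Z i ω j * Z i ω k) μ := fun i j k => by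
    refine Integrable.of_bound ((hZj i j).mul (hZj i k)).aestronglyMeasurable (√L * √L) ?_
    filter_upwards [hZbd i] with ω h
    rw [norm_mul]
    exact mul_le_mul (h j) (h k) (norm_nonneg _) (Real.sqrt_nonneg _)
  have hindep : ∀ m j k j' k', IndepFun (fun ω => E m ω j k) (fun ω => Z m ω j' * Z m ω k') μ := by
    intro m j k j' k'
    have h := hind.indepFun_finset (Finset.range m) {m} (by simp) hZ
    have h2 : Measurable fun y : ({m} : Finset ℕ) → κ → ℝ =>
        y ⟨m, by simp⟩ j' * y ⟨m, by simp⟩ k' := by fun_prop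
    have h3 := h.comp (hcont m j k).measurable h2
    have h4 : (fun ω => E m ω j k) = (fun y : Finset.range m → κ → ℝ => NormedSpace.exp ((-L⁻¹) •
        ∑ i, vecMulVec (y i) (y i)) j k) ∘ fun ω i => Z i ω := funext fun ω => hEeq m ω j k
    rw [h4]
    exact h3
  set c := (1 - Real.exp (-1)) / L with hc
  set Φ : ℕ → ℝ := fun m => ∫ ω, (E m ω).trace ∂μ with hΦ
  have htrint : ∀ m, Integrable (fun ω => (E m ω).trace) μ := fun m =>
    integrable_finsetSum _ fun j _ => hEint m j j
  have hΦ0 : ∀ m, 0 ≤ Φ m := fun m => integral_nonneg fun ω => trace_exp_nonneg (hsT m ω)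
  have hq : ∀ m ω, Z m ω ⬝ᵥ (E m ω *ᵥ Z m ω) =
      ∑ j, ∑ k, E m ω j k * (Z m ω j * Z m ω k) := fun m ω => by
    simp only [dotProduct, mulVec, Finset.mul_sum]
    exact Finset.sum_congr rfl fun j _ => Finset.sum_congr rfl fun k _ => by ring
  have hqi : ∀ m j k, Integrable (fun ω => E m ω j k * (Z m ω j * Z m ω k)) μ := fun m j k =>
    (hindep m j k j k).integrable_mul (hEint m j k) (hZZint m j k)
  have hstep : ∀ m, Φ (m + 1) ≤ Real.exp (-c) * Φ m := fun m => by
    have h1 : Φ (m + 1) ≤ ∫ ω, ((E m ω).trace - c * (Z m ω ⬝ᵥ (E m ω *ᵥ Z m ω))) ∂μ := by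
      refine integral_mono_ae (htrint _) ((htrint m).sub (Integrable.const_mul ?_ _)) ?_
      · simp only [hq]
        exact integrable_finsetSum _ fun j _ => integrable_finsetSum _ fun k _ => hqi m j k
      · filter_upwards [hbd m] with ω h
        have := trace_exp_add_vecMulVec_le (hMT m ω) hL h
        simpa only [hEdef, hMdef, Finset.sum_range_succ] using this
    have h2 : ∫ ω, Z m ω ⬝ᵥ (E m ω *ᵥ Z m ω) ∂μ = Φ m := by
      simp only [hq]
      rw [integral_finsetSum _ fun j _ => integrable_finsetSum _ fun k _ => hqi m j k]
      simp only [hΦ, trace, diag_apply]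
      rw [integral_finsetSum _ fun j _ => hEint m j j]
      refine Finset.sum_congr rfl fun j _ => ?_
      rw [integral_finsetSum _ fun k _ => hqi m j k]
      rw [Finset.sum_eq_single j]
      · rw [(hindep m j j j j).integral_fun_mul_eq_mul_integral (hEint m j j).1 (hZZint m j j).1,
          hiso, if_pos rfl, mul_one]
      · intro k _ hk
        rw [(hindep m j k j k).integral_fun_mul_eq_mul_integral (hEint m j k).1 (hZZint m j k).1,
          hiso, if_neg hk.symm, mul_zero]
      · simp
    rw [integral_sub (htrint m) (Integrable.const_mul (by
      simp only [hq]
      exact integrable_finsetSum _ fun j _ => integrable_finsetSum _ fun k _ => hqi m j k) _),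
      integral_const_mul, h2] at h1
    have h3 : 1 - c ≤ Real.exp (-c) := by linarith [Real.add_one_le_exp (-c)]
    have h4 := mul_le_mul_of_nonneg_right h3 (hΦ0 m)
    change Φ (m + 1) ≤ Φ m - c * Φ m at h1
    linarith
  have hΦn : Φ n ≤ Real.exp (-c) ^ n * Fintype.card κ := by
    have h0 : Φ 0 = Fintype.card κ := by simp [hΦ, hEdef, hMdef]
    suffices ∀ m, Φ m ≤ Real.exp (-c) ^ m * Φ 0 from h0 ▸ this n
    intro m
    induction m with
    | zero => simp
    | succ m ih =>
      refine (hstep m).trans ((mul_le_mul_of_nonneg_left ih (Real.exp_pos _).le).trans_eq ?_)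
      ring
  have hmarkov := mul_meas_ge_le_integral_of_nonneg
    (ae_of_all μ fun ω => trace_exp_nonneg (hsT n ω)) (htrint n) (Real.exp (-(L⁻¹ * (n / 2))))
  have hsub : μ.real {ω | ∃ v : κ → ℝ, ∑ i ∈ Finset.range n, (Z i ω ⬝ᵥ v) ^ 2 <
      n / 2 * (v ⬝ᵥ v)} ≤ μ.real {ω | Real.exp (-(L⁻¹ * (n / 2))) ≤ (E n ω).trace} := by
    refine measureReal_mono ?_
    rintro ω ⟨v, hv⟩
    exact exp_le_trace_exp (hMT n ω) (inv_nonneg.2 hL.le)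
      (by rwa [dotProduct_sum_vecMulVec_mulVec])
  have h5 : μ.real {ω | Real.exp (-(L⁻¹ * (n / 2))) ≤ (E n ω).trace} ≤
      Real.exp (L⁻¹ * (n / 2)) * Φ n := by
    rw [Real.exp_neg] at hmarkov ⊢
    exact (inv_mul_le_iff₀ (Real.exp_pos _)).1 hmarkov
  refine hsub.trans (h5.trans ((mul_le_mul_of_nonneg_left hΦn (Real.exp_pos _).le).trans ?_))
  rw [← Real.exp_nat_mul, ← mul_assoc, ← Real.exp_add, mul_comm]
  gcongr
  have he : Real.exp (-1) ≤ 2 / 5 := by linarith [Real.exp_neg_one_lt_d9]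
  have h6 : 3 / 5 * L⁻¹ ≤ c := by
    rw [hc, div_eq_mul_inv]
    exact mul_le_mul_of_nonneg_right (by linarith) (inv_nonneg.2 hL.le)
  have h7 : (n : ℝ) * (3 / 5 * L⁻¹) ≤ n * c := by gcongr
  have h8 : (n : ℝ) / (10 * L) = n * L⁻¹ / 10 := by field_simp
  rw [h8]
  linarith

/-! ### Whitening the basis functions -/

namespace SeriesLS

section InvSqrt

variable {K : ℕ} {A : Matrix (Fin K) (Fin K) ℝ}

lemma continuousOn_spectrum (f : ℝ → ℝ) : ContinuousOn f (spectrum ℝ A) :=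
  A.finite_real_spectrum.continuousOn f

lemma lambdaMin_le_of_mem_spectrum {x : ℝ} (hx : x ∈ spectrum ℝ A) : lambdaMin A ≤ x :=
  csInf_le A.finite_real_spectrum.bddBelow hx

lemma invSqrt_transpose : (invSqrt A).transpose = invSqrt A := by
  have h : IsSelfAdjoint (invSqrt A) := cfc_predicate _ _
  have h' := h.star_eq
  rwa [Matrix.star_eq_conjTranspose, Matrix.conjTranspose_eq_transpose_of_trivial] at h'

lemma invSqrt_mul_mul_invSqrt (hA : A.IsHermitian) (hpos : 0 < lambdaMin A) :
    invSqrt A * A * invSqrt A = 1 := by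
  have hA' : IsSelfAdjoint A := hA
  rw [invSqrt]
  nth_rewrite 2 [← cfc_id' ℝ A]
  rw [← cfc_mul _ _ A (continuousOn_spectrum _) (continuousOn_spectrum _),
    ← cfc_mul _ _ A (continuousOn_spectrum _) (continuousOn_spectrum _), ← cfc_one ℝ A]
  refine cfc_congr fun x hx => ?_
  have hx0 : 0 < x := hpos.trans_le (lambdaMin_le_of_mem_spectrum hx)
  have h := Real.mul_self_sqrt hx0.le
  have h' : 0 < √x := Real.sqrt_pos.2 hx0
  simp only [Pi.one_apply]
  field_simp
  linarith

/-- `A⁻¹ ≤ λ_min(A)⁻¹` as quadratic forms. The difference is the square of a symmetric matrix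
given by the functional calculus. -/
lemma dotProduct_vecMul_invSqrt_le (hA : A.IsHermitian) (hpos : 0 < lambdaMin A)
    (v : Fin K → ℝ) :
    Matrix.vecMul v (invSqrt A) ⬝ᵥ Matrix.vecMul v (invSqrt A) ≤ (lambdaMin A)⁻¹ * (v ⬝ᵥ v) := by
  have hA' : IsSelfAdjoint A := hA
  set D := cfc (fun x : ℝ => √((lambdaMin A)⁻¹ - x⁻¹)) A with hD
  have hDT : D.transpose = D := by
    have h : IsSelfAdjoint D := cfc_predicate _ _
    have h' := h.star_eq
    rwa [Matrix.star_eq_conjTranspose, Matrix.conjTranspose_eq_transpose_of_trivial] at h'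
  have key : invSqrt A * invSqrt A + D * D = (lambdaMin A)⁻¹ • (1 : Matrix (Fin K) (Fin K) ℝ) := by
    rw [invSqrt, hD, ← cfc_mul _ _ A (continuousOn_spectrum _) (continuousOn_spectrum _),
      ← cfc_mul _ _ A (continuousOn_spectrum _) (continuousOn_spectrum _),
      ← cfc_add A _ _ (continuousOn_spectrum _) (continuousOn_spectrum _), ← cfc_one ℝ A,
      ← cfc_smul _ _ A (continuousOn_spectrum _)]
    refine cfc_congr fun x hx => ?_
    have hle := lambdaMin_le_of_mem_spectrum hx
    have hx0 : 0 < x := hpos.trans_le hle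
    have h1 : 0 ≤ (lambdaMin A)⁻¹ - x⁻¹ := sub_nonneg.2 (inv_anti₀ hpos hle)
    have h2 : (√x)⁻¹ * (√x)⁻¹ = x⁻¹ := by rw [← mul_inv, Real.mul_self_sqrt hx0.le]
    simp only [Pi.one_apply, smul_eq_mul, mul_one, Real.mul_self_sqrt h1, h2]
    ring
  have hquad : ∀ S : Matrix (Fin K) (Fin K) ℝ, S.transpose = S →
      Matrix.vecMul v S ⬝ᵥ Matrix.vecMul v S = Matrix.vecMul v (S * S) ⬝ᵥ v := fun S hS => by
    rw [← Matrix.vecMul_vecMul, ← Matrix.dotProduct_mulVec (Matrix.vecMul v S) S v,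
      ← Matrix.vecMul_transpose, hS]
  have h3 : 0 ≤ Matrix.vecMul v D ⬝ᵥ Matrix.vecMul v D :=
    Finset.sum_nonneg fun i _ => mul_self_nonneg _
  have h4 := congrArg (fun S => Matrix.vecMul v S ⬝ᵥ v) key
  simp only [Matrix.vecMul_add, add_dotProduct, Matrix.vecMul_smul, Matrix.vecMul_one,
    smul_dotProduct, smul_eq_mul] at h4
  rw [hquad _ hDT] at h3
  rw [hquad _ invSqrt_transpose]
  linarith

end InvSqrt

section Whiten

variable {d K : ℕ} (F : Measure (EuclideanSpace ℝ (Fin d)))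
  (q : EuclideanSpace ℝ (Fin d) → EuclideanSpace ℝ (Fin K))

/-- The whitened basis functions `w ↦ Q^{-1/2} p_K(w)`, whose Gram matrix is the identity. -/
noncomputable def whiten (w : EuclideanSpace ℝ (Fin d)) : EuclideanSpace ℝ (Fin K) :=
  WithLp.toLp 2 (Matrix.vecMul (q w).ofLp (invSqrt (gram F q)))

/-- The coefficients `Q^{1/2} b` of `p_Kᵀ b` with respect to the whitened basis functions. -/
noncomputable def whitenCoef (b : EuclideanSpace ℝ (Fin K)) : EuclideanSpace ℝ (Fin K) :=
  WithLp.toLp 2 ((gram F q * invSqrt (gram F q)).mulVec b.ofLp)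

lemma gram_isHermitian : (gram F q).IsHermitian := by
  ext i j
  simp [gram, mul_comm]

variable {F q}

lemma whiten_apply (w : EuclideanSpace ℝ (Fin d)) (k : Fin K) :
    whiten F q w k = ∑ j, q w j * invSqrt (gram F q) j k := rfl

lemma inner_whiten_whitenCoef (hpos : 0 < lambdaMin (gram F q)) (b : EuclideanSpace ℝ (Fin K))
    (w : EuclideanSpace ℝ (Fin d)) : inner ℝ (whiten F q w) (whitenCoef F q b) = lin q b w := by
  have h := invSqrt_mul_mul_invSqrt (gram_isHermitian F q) hpos
  rw [EuclideanSpace.inner_eq_star_dotProduct, dotProduct_comm]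
  simp only [whiten, whitenCoef, star_trivial]
  rw [Matrix.dotProduct_mulVec, Matrix.vecMul_vecMul, ← mul_assoc, h, Matrix.vecMul_one]
  rfl

lemma measurable_whiten (hq : Measurable q) : Measurable (whiten F q) := by
  have : ∀ j, Measurable fun w => q w j := fun j => by fun_prop
  refine (WithLp.measurable_toLp 2 _).comp (measurable_pi_lambda _ fun k => ?_)
  simp only [Matrix.vecMul, dotProduct]
  exact Finset.measurable_sum _ fun j _ => (this j).mul_const _

lemma memLp_whiten_apply (hq2 : MemLp q 2 F) (k : Fin K) : MemLp (fun w => whiten F q w k) 2 F := by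
  simp only [whiten_apply]
  refine memLp_finsetSum _ fun j _ => ?_
  have : MemLp (fun w => q w j) 2 F := hq2.eval_piLp j
  exact this.mul_const _

lemma integral_whiten_mul_whiten (hq2 : MemLp q 2 F) (hpos : 0 < lambdaMin (gram F q))
    (j k : Fin K) : ∫ w, whiten F q w j * whiten F q w k ∂F = if j = k then 1 else 0 := by
  have h := invSqrt_mul_mul_invSqrt (gram_isHermitian F q) hpos
  set T := invSqrt (gram F q)
  have hqj : ∀ j, MemLp (fun w => q w j) 2 F := fun j => hq2.eval_piLp j
  have hint : ∀ a b, Integrable (fun w => T a j * T b k * (q w a * q w b)) F := fun a b =>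
    ((hqj a).integrable_mul (hqj b)).const_mul _
  have e : ∀ w, whiten F q w j * whiten F q w k =
      ∑ a, ∑ b, T a j * T b k * (q w a * q w b) := fun w => by
    rw [whiten_apply, whiten_apply, Finset.sum_mul_sum]
    exact Finset.sum_congr rfl fun a _ => Finset.sum_congr rfl fun b _ => by ring
  simp only [e]
  rw [integral_finsetSum _ fun a _ => integrable_finsetSum _ fun b _ => hint a b]
  have e2 : ∀ a, ∫ w, ∑ b, T a j * T b k * (q w a * q w b) ∂F =
      ∑ b, T j a * gram F q a b * T b k := fun a => by
    rw [integral_finsetSum _ fun b _ => hint a b]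
    refine Finset.sum_congr rfl fun b _ => ?_
    have hsymm : T j a = T a j := congrFun (congrFun invSqrt_transpose a) j
    rw [integral_const_mul, hsymm, gram, Matrix.of_apply]
    ring
  rw [← Matrix.one_apply, ← h, Matrix.mul_apply]
  simp only [e2, Matrix.mul_apply, Finset.sum_mul]
  exact Finset.sum_comm

lemma norm_whiten_sq_le (hpos : 0 < lambdaMin (gram F q)) (w : EuclideanSpace ℝ (Fin d)) :
    ‖whiten F q w‖ ^ 2 ≤ (lambdaMin (gram F q))⁻¹ * ‖q w‖ ^ 2 := by
  have h := dotProduct_vecMul_invSqrt_le (gram_isHermitian F q) hpos (q w).ofLp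
  simpa [EuclideanSpace.real_norm_sq_eq, dotProduct, ← sq, whiten] using h

lemma sum_inner_whiten_sub_sq_le {n : ℕ} (hn : 0 < n)
    (w x : Fin n → EuclideanSpace ℝ (Fin d)) (v : EuclideanSpace ℝ (Fin K)) :
    ∑ i, inner ℝ (whiten F q (w i) - whiten F q (x i)) v ^ 2 ≤ n * Bn F q w x * ‖v‖ ^ 2 := by
  have hn' : (0 : ℝ) < n := by exact_mod_cast hn
  set A := (design q w - design q x) * invSqrt (gram F q) with hA
  have h1 : ‖Matrix.toEuclideanLin A v‖ ^ 2 ≤ spectralNorm A ^ 2 * ‖v‖ ^ 2 := by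
    rw [← mul_pow]
    exact pow_le_pow_left₀ (norm_nonneg _)
      ((LinearMap.toContinuousLinearMap (Matrix.toEuclideanLin A)).le_opNorm v) 2
  have h2 : ∑ i, inner ℝ (whiten F q (w i) - whiten F q (x i)) v ^ 2 =
      ‖Matrix.toEuclideanLin A v‖ ^ 2 := by
    rw [EuclideanSpace.real_norm_sq_eq]
    refine Finset.sum_congr rfl fun i _ => ?_
    congr 1
    rw [EuclideanSpace.inner_eq_star_dotProduct, dotProduct_comm]
    simp only [star_trivial, whiten, Matrix.toLpLin_apply, Matrix.mulVec]
    congr 1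
    ext k
    simp [hA, Matrix.vecMul, dotProduct, Matrix.mul_apply, design, sub_mul]
  rw [h2, Bn, mul_div_cancel₀ _ hn'.ne']
  exact h1

end Whiten

end SeriesLS

/-! ### Least squares with perturbed regressors -/

lemma eq_zero_of_forall_mul_add_sq_mul_nonneg {a c : ℝ} (h : ∀ t : ℝ, 0 ≤ t * a + t ^ 2 * c) :
    a = 0 := by
  have hd := discrim_le_zero (a := c) (b := a) (c := 0) fun t => by nlinarith [h t]
  rw [discrim] at hd
  nlinarith [sq_nonneg a]

section Perturbed

variable {H : Type*} [NormedAddCommGroup H] [InnerProductSpace ℝ H] {n : ℕ}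

/-- A perturbation of the regressors that is small in operator norm keeps the Gram form bounded
below. -/
lemma norm_sq_le_sum_inner_sq {x y : Fin n → H} {b : ℝ} (hb : b ≤ 1 / 16)
    (hx : ∀ v, n / 2 * ‖v‖ ^ 2 ≤ ∑ i, inner ℝ (x i) v ^ 2)
    (hxy : ∀ v, ∑ i, inner ℝ (x i - y i) v ^ 2 ≤ n * b * ‖v‖ ^ 2) (v : H) :
    n * ‖v‖ ^ 2 ≤ 8 * ∑ i, inner ℝ (y i) v ^ 2 := by
  have h1 : ∑ i, inner ℝ (x i) v ^ 2 ≤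
      2 * ∑ i, inner ℝ (y i) v ^ 2 + 2 * ∑ i, inner ℝ (x i - y i) v ^ 2 := by
    rw [Finset.mul_sum, Finset.mul_sum, ← Finset.sum_add_distrib]
    refine Finset.sum_le_sum fun i _ => ?_
    rw [inner_sub_left]
    nlinarith [sq_nonneg (2 * inner ℝ (y i) v - inner ℝ (x i) v)]
  have h2 : n * b * ‖v‖ ^ 2 ≤ n * (1 / 16) * ‖v‖ ^ 2 := by gcongr
  have := hx v
  have := hxy v
  nlinarith [mul_nonneg (Nat.cast_nonneg n : (0 : ℝ) ≤ n) (sq_nonneg ‖v‖)]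

/-- Young's inequality: a term linear in the length `D` of a vector is absorbed into the Gram form
`a`, which dominates `n D² / 8`. -/
lemma mul_le_of_mul_sq_le {n D a u : ℝ} (hn : 0 < n) (hD : n * D ^ 2 ≤ 8 * a) :
    D * u ≤ a / 8 + 16 * (u ^ 2 / n) := by
  have h : D * u ≤ n * D ^ 2 / 64 + 16 * (u ^ 2 / n) := by
    have e : n * D ^ 2 / 64 + 16 * (u ^ 2 / n) - D * u = (n * D / 8 - 4 * u) ^ 2 / n := by
      field_simp; ring
    have : 0 ≤ (n * D / 8 - 4 * u) ^ 2 / n := by positivity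
    linarith
  linarith

lemma inner_sum_smul_le (x : Fin n → H) (u : Fin n → ℝ) (δ : H) :
    ∑ i, inner ℝ (x i) δ * u i ≤ ‖δ‖ * ‖∑ i, u i • x i‖ := by
  have e : ∑ i, inner ℝ (x i) δ * u i = inner ℝ δ (∑ i, u i • x i) := by
    rw [inner_sum]
    refine Finset.sum_congr rfl fun i _ => ?_
    rw [real_inner_smul_right, real_inner_comm, mul_comm]
  rw [e]
  exact real_inner_le_norm _ _

variable {x y : Fin n → H} {b : ℝ} {u e : Fin n → ℝ} {γ δ : H}

/-- The coefficient error `δ` of least squares with regressors `y i`, where `hδ` is the normal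
equation in the direction `δ`. The approximation errors `e i + ⟪x i - y i, γ⟫` are bounded by their
Euclidean length. -/
lemma norm_sq_le_of_normal_eq (hn : 0 < n) (hb : b ≤ 1 / 16)
    (hx : ∀ v, n / 2 * ‖v‖ ^ 2 ≤ ∑ i, inner ℝ (x i) v ^ 2)
    (hxy : ∀ v, ∑ i, inner ℝ (x i - y i) v ^ 2 ≤ n * b * ‖v‖ ^ 2)
    (hδ : ∑ i, inner ℝ (y i) δ ^ 2 =
      ∑ i, inner ℝ (y i) δ * (u i + (e i + inner ℝ (x i - y i) γ))) :
    ‖δ‖ ^ 2 ≤ 256 * (‖∑ i, u i • y i‖ ^ 2 / n ^ 2 +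
      (∑ i, (e i + inner ℝ (x i - y i) γ) ^ 2) / n) := by
  have hn' : (0 : ℝ) < n := by exact_mod_cast hn
  have hD := norm_sq_le_sum_inner_sq hb hx hxy δ
  set a := ∑ i, inner ℝ (y i) δ ^ 2
  set r : Fin n → ℝ := fun i => e i + inner ℝ (x i - y i) γ
  have h1 := inner_sum_smul_le y u δ
  have h2 := mul_le_of_mul_sq_le (u := ‖∑ i, u i • y i‖) hn' hD
  have h3 : ∑ i, inner ℝ (y i) δ * r i ≤ a / 4 + ∑ i, r i ^ 2 := by
    rw [Finset.sum_div, ← Finset.sum_add_distrib]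
    exact Finset.sum_le_sum fun i _ => by nlinarith [sq_nonneg (inner ℝ (y i) δ / 2 - r i)]
  have h4 : a ≤ 32 * (‖∑ i, u i • y i‖ ^ 2 / n) + 2 * ∑ i, r i ^ 2 := by
    simp only [mul_add, Finset.sum_add_distrib] at hδ
    have hδ' : a = ∑ i, inner ℝ (y i) δ * u i + ∑ i, inner ℝ (y i) δ * r i := by
      rw [hδ, ← Finset.sum_add_distrib, ← Finset.sum_add_distrib, ← Finset.sum_add_distrib]
      exact Finset.sum_congr rfl fun i _ => by simp only [r]; ring
    have : 0 ≤ ∑ i, r i ^ 2 := Finset.sum_nonneg fun i _ => sq_nonneg _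
    have : 0 ≤ ‖∑ i, u i • y i‖ ^ 2 / n := by positivity
    linarith
  have h5 : ‖δ‖ ^ 2 ≤ 8 * (32 * (‖∑ i, u i • y i‖ ^ 2 / n) + 2 * ∑ i, r i ^ 2) / n := by
    rw [le_div_iff₀ hn']; linarith
  refine h5.trans ?_
  have : 0 ≤ (∑ i, r i ^ 2) / n := by positivity
  have e1 : 8 * (32 * (‖∑ i, u i • y i‖ ^ 2 / n) + 2 * ∑ i, r i ^ 2) / n =
      256 * (‖∑ i, u i • y i‖ ^ 2 / n ^ 2) + 16 * ((∑ i, r i ^ 2) / n) := by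
    field_simp; ring
  rw [e1]
  linarith

/-- The coefficient error `δ` as in `norm_sq_le_of_normal_eq`, but with the approximation errors
`e i` entering only through `∑ e i • x i`, which is of smaller order if `e` is orthogonal to the
regressors in expectation, and through a term that is small with the perturbation. -/
lemma norm_sq_le_of_normal_eq' (hn : 0 < n) (hb0 : 0 ≤ b) (hb : b ≤ 1 / 16)
    (hx : ∀ v, n / 2 * ‖v‖ ^ 2 ≤ ∑ i, inner ℝ (x i) v ^ 2)
    (hxy : ∀ v, ∑ i, inner ℝ (x i - y i) v ^ 2 ≤ n * b * ‖v‖ ^ 2)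
    (hδ : ∑ i, inner ℝ (y i) δ ^ 2 =
      ∑ i, inner ℝ (y i) δ * (u i + (e i + inner ℝ (x i - y i) γ))) :
    ‖δ‖ ^ 2 ≤ 256 * (‖∑ i, u i • y i‖ ^ 2 / n ^ 2 + ‖∑ i, e i • x i‖ ^ 2 / n ^ 2 +
      b * ((∑ i, e i ^ 2) / n) + b * ‖γ‖ ^ 2) := by
  have hn' : (0 : ℝ) < n := by exact_mod_cast hn
  have hD := norm_sq_le_sum_inner_sq hb hx hxy δ
  set a := ∑ i, inner ℝ (y i) δ ^ 2
  have hs := hxy γ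
  have h1 := inner_sum_smul_le y u δ
  have h1' := inner_sum_smul_le x e δ
  have h2 := mul_le_of_mul_sq_le (u := ‖∑ i, u i • y i‖) hn' hD
  have h2' := mul_le_of_mul_sq_le (u := ‖∑ i, e i • x i‖) hn' hD
  have h2'' := mul_le_of_mul_sq_le (u := √(n * b * ∑ i, e i ^ 2)) hn' hD
  have he0 : 0 ≤ ∑ i, e i ^ 2 := Finset.sum_nonneg fun i _ => sq_nonneg _
  have hcancel : n * b * (∑ i, e i ^ 2) / n = b * ∑ i, e i ^ 2 := by field_simp
  rw [Real.sq_sqrt (by positivity), hcancel] at h2''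
  have h3 : ∑ i, inner ℝ (y i) δ * inner ℝ (x i - y i) γ ≤
      a / 8 + 2 * ∑ i, inner ℝ (x i - y i) γ ^ 2 := by
    rw [Finset.sum_div, Finset.mul_sum, ← Finset.sum_add_distrib]
    exact Finset.sum_le_sum fun i _ => by
      nlinarith [sq_nonneg (inner ℝ (y i) δ / 2 - 2 * inner ℝ (x i - y i) γ)]
  have h5 : -∑ i, inner ℝ (x i - y i) δ * e i ≤ ‖δ‖ * √(n * b * ∑ i, e i ^ 2) := by
    rw [← Real.sqrt_sq (norm_nonneg δ), ← Real.sqrt_mul (sq_nonneg _)]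
    refine (neg_le_abs _).trans (Real.abs_le_sqrt ?_)
    refine (Finset.sum_mul_sq_le_sq_mul_sq _ _ _).trans ?_
    refine (mul_le_mul_of_nonneg_right (hxy δ) he0).trans_eq ?_
    ring
  have hδ' : a = ∑ i, inner ℝ (y i) δ * u i + (∑ i, inner ℝ (x i) δ * e i -
      ∑ i, inner ℝ (x i - y i) δ * e i) + ∑ i, inner ℝ (y i) δ * inner ℝ (x i - y i) γ := by
    rw [hδ, ← Finset.sum_sub_distrib, ← Finset.sum_add_distrib, ← Finset.sum_add_distrib]
    refine Finset.sum_congr rfl fun i _ => ?_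
    rw [inner_sub_left (x i) (y i) δ]
    ring
  have h6 : a ≤ 32 * (‖∑ i, u i • y i‖ ^ 2 / n) + 32 * (‖∑ i, e i • x i‖ ^ 2 / n) +
      32 * (b * ∑ i, e i ^ 2) + 4 * (n * b * ‖γ‖ ^ 2) := by linarith
  have h7 : ‖δ‖ ^ 2 ≤ 8 * (32 * (‖∑ i, u i • y i‖ ^ 2 / n) + 32 * (‖∑ i, e i • x i‖ ^ 2 / n) +
      32 * (b * ∑ i, e i ^ 2) + 4 * (n * b * ‖γ‖ ^ 2)) / n := by
    rw [le_div_iff₀ hn']; linarith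
  refine h7.trans ?_
  have e1 : 8 * (32 * (‖∑ i, u i • y i‖ ^ 2 / n) + 32 * (‖∑ i, e i • x i‖ ^ 2 / n) +
      32 * (b * ∑ i, e i ^ 2) + 4 * (n * b * ‖γ‖ ^ 2)) / n =
      256 * (‖∑ i, u i • y i‖ ^ 2 / n ^ 2) + 256 * (‖∑ i, e i • x i‖ ^ 2 / n ^ 2) +
      256 * (b * ((∑ i, e i ^ 2) / n)) + 32 * (b * ‖γ‖ ^ 2) := by
    field_simp; ring
  rw [e1]
  have : 0 ≤ b * ‖γ‖ ^ 2 := by positivity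
  linarith

end Perturbed

namespace SeriesLS

section NormalEquations

variable {d K n : ℕ} {q : EuclideanSpace ℝ (Fin d) → EuclideanSpace ℝ (Fin K)}

lemma lin_add_smul (b c : EuclideanSpace ℝ (Fin K)) (t : ℝ) (w : EuclideanSpace ℝ (Fin d)) :
    lin q (b + t • c) w = lin q b w + t * lin q c w := by
  simp only [lin, Finset.mul_sum, ← Finset.sum_add_distrib, PiLp.add_apply, PiLp.smul_apply,
    smul_eq_mul]
  exact Finset.sum_congr rfl fun k _ => by ring

lemma lin_sub (b c : EuclideanSpace ℝ (Fin K)) (w : EuclideanSpace ℝ (Fin d)) :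
    lin q (b - c) w = lin q b w - lin q c w := by
  simp only [lin, ← Finset.sum_sub_distrib, PiLp.sub_apply, mul_sub]

/-- The normal equations of the sample least squares problem. -/
lemma sum_mul_lin_eq_zero (hn : 0 < n) {y : Fin n → ℝ} {x : Fin n → EuclideanSpace ℝ (Fin d)}
    {b : EuclideanSpace ℝ (Fin K)} (hb : IsMinOn (lsLoss q y x) Set.univ b)
    (c : EuclideanSpace ℝ (Fin K)) : ∑ i, (y i - lin q b (x i)) * lin q c (x i) = 0 := by
  have hn' : (0 : ℝ) < n := by exact_mod_cast hn
  have h : (-2 * ∑ i, (y i - lin q b (x i)) * lin q c (x i)) = 0 := by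
    refine eq_zero_of_forall_mul_add_sq_mul_nonneg (c := ∑ i, lin q c (x i) ^ 2) fun t => ?_
    have h1 := isMinOn_iff.1 hb (b + t • c) (Set.mem_univ _)
    rw [lsLoss, lsLoss] at h1
    have h2 := le_of_mul_le_mul_left h1 (by positivity)
    rw [← sub_nonneg, ← Finset.sum_sub_distrib] at h2
    refine h2.trans_eq ?_
    rw [Finset.mul_sum, Finset.mul_sum, Finset.mul_sum, ← Finset.sum_add_distrib]
    refine Finset.sum_congr rfl fun i _ => ?_
    rw [lin_add_smul]
    ring
  linarith

/-- The normal equations of the population least squares problem. -/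
lemma integral_mul_lin_eq_zero {Ω : Type*} [MeasurableSpace Ω] {μ : Measure Ω} {Y : Ω → ℝ}
    {W : Ω → EuclideanSpace ℝ (Fin d)} (hY : MemLp Y 2 μ)
    (hq : ∀ b, MemLp (fun ω => lin q b (W ω)) 2 μ) {b : EuclideanSpace ℝ (Fin K)}
    (hb : IsMinOn (fun b => ∫ ω, (Y ω - lin q b (W ω)) ^ 2 ∂μ) Set.univ b)
    (c : EuclideanSpace ℝ (Fin K)) :
    ∫ ω, (Y ω - lin q b (W ω)) * lin q c (W ω) ∂μ = 0 := by
  have h : (-2 * ∫ ω, (Y ω - lin q b (W ω)) * lin q c (W ω) ∂μ) = 0 := by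
    refine eq_zero_of_forall_mul_add_sq_mul_nonneg (c := ∫ ω, lin q c (W ω) ^ 2 ∂μ) fun t => ?_
    have h1 := isMinOn_iff.1 hb (b + t • c) (Set.mem_univ _)
    have i1 : Integrable (fun ω => (Y ω - lin q b (W ω)) ^ 2) μ := (hY.sub (hq b)).integrable_sq
    have i2 : Integrable (fun ω => (Y ω - lin q b (W ω)) * lin q c (W ω)) μ :=
      (hY.sub (hq b)).integrable_mul (hq c)
    have i3 : Integrable (fun ω => lin q c (W ω) ^ 2) μ := (hq c).integrable_sq
    have e : ∀ ω, (Y ω - lin q (b + t • c) (W ω)) ^ 2 = (Y ω - lin q b (W ω)) ^ 2 +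
        (t * (-2) * ((Y ω - lin q b (W ω)) * lin q c (W ω)) + t ^ 2 * lin q c (W ω) ^ 2) :=
      fun ω => by rw [lin_add_smul]; ring
    simp only [e] at h1
    have i4 : Integrable (fun ω => t * (-2) * ((Y ω - lin q b (W ω)) * lin q c (W ω)) +
        t ^ 2 * lin q c (W ω) ^ 2) μ := (i2.const_mul _).add (i3.const_mul _)
    rw [integral_add i1 i4,
      integral_add (i2.const_mul _) (i3.const_mul _), integral_const_mul, integral_const_mul] at h1
    linarith
  linarith

end NormalEquations

end SeriesLS

/-! ### Moment bounds for the stochastic terms -/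

lemma EuclideanSpace.enorm_sq_eq_sum {κ : Type*} [Fintype κ] (x : EuclideanSpace ℝ κ) :
    ‖x‖ₑ ^ 2 = ∑ k, ‖x k‖ₑ ^ 2 := by
  have h : ∀ r : ℝ, ‖r‖ₑ ^ 2 = ENNReal.ofReal (r ^ 2) := fun r => by
    rw [← enorm_pow, Real.enorm_of_nonneg (sq_nonneg r)]
  simp only [h]
  rw [← ofReal_norm, ← ENNReal.ofReal_pow (norm_nonneg _), EuclideanSpace.real_norm_sq_eq,
    ENNReal.ofReal_sum_of_nonneg fun _ _ => sq_nonneg _]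

section Markov

variable {Ω : Type*} [MeasurableSpace Ω] {μ : Measure Ω}

/-- Markov's inequality with a strict inequality, valid also if the bound `a` is `0` or `∞`. -/
lemma measure_mul_lt_le_inv {f : Ω → ℝ≥0∞} (hf : AEMeasurable f μ) {a : ℝ≥0∞}
    (ha : ∫⁻ ω, f ω ∂μ ≤ a) {M : ℝ≥0} (hM : M ≠ 0) :
    μ {ω | (M : ℝ≥0∞) * a < f ω} ≤ (M : ℝ≥0∞)⁻¹ := by
  have hM' : (M : ℝ≥0∞) ≠ 0 := by exact_mod_cast hM
  rcases eq_or_ne a 0 with rfl | h0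
  · have h := (lintegral_eq_zero_iff' hf).1 (le_antisymm ha zero_le)
    have : μ {ω | (M : ℝ≥0∞) * 0 < f ω} = 0 := by
      refine measure_mono_null (fun ω hω => ?_) (ae_iff.1 h)
      simpa [pos_iff_ne_zero] using hω
    rw [this]
    exact zero_le
  rcases eq_or_ne a ∞ with rfl | ht
  · simp [ENNReal.mul_top hM']
  · have hsub : {ω | (M : ℝ≥0∞) * a < f ω} ⊆ {ω | (M : ℝ≥0∞) * a ≤ f ω} :=
      fun ω hω => le_of_lt (Set.mem_ofPred_eq ▸ hω)
    refine (measure_mono hsub).trans ((meas_ge_le_lintegral_div hf (mul_ne_zero hM' h0)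
        (ENNReal.mul_ne_top ENNReal.coe_ne_top ht)).trans ?_)
    refine (ENNReal.div_le_div_right ha _).trans_eq ?_
    rw [ENNReal.div_eq_inv_mul, ENNReal.mul_inv (Or.inl hM') (Or.inl ENNReal.coe_ne_top), mul_assoc,
      ENNReal.inv_mul_cancel h0 ht, mul_one]

end Markov

section Independent

variable {Ω X : Type*} [MeasurableSpace Ω] [MeasurableSpace X] {μ : Measure Ω}
  [IsProbabilityMeasure μ] {W : ℕ → Ω → X} {F : Measure X}

lemma lintegral_enorm_sum_sq (hW : ∀ i, Measurable (W i)) (hind : iIndepFun W μ)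
    (hF : ∀ i, μ.map (W i) = F) {h : X → ℝ} (hm : Measurable h) (h2 : MemLp h 2 F)
    (h0 : ∫ x, h x ∂F = 0) (n : ℕ) :
    ∫⁻ ω, ‖∑ i : Fin n, h (W i ω)‖ₑ ^ 2 ∂μ = n * ∫⁻ x, ‖h x‖ₑ ^ 2 ∂F := by
  have hL2 : ∀ i : Fin n, MemLp (fun ω => h (W i ω)) 2 μ := fun i =>
    (hF i ▸ h2).comp_of_map (hW i).aemeasurable
  have hint : ∀ i : Fin n, ∫ ω, h (W i ω) ∂μ = 0 := fun i => by
    rw [← h0, ← hF i, integral_map (hW i).aemeasurable hm.aestronglyMeasurable]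
  have hev : ∀ f : Ω → ℝ, ∫ ω, f ω ∂μ = 0 → evariance f μ = ∫⁻ ω, ‖f ω‖ₑ ^ 2 ∂μ := fun f hf => by
    simp [evariance, hf]
  have hsum : MemLp (∑ i : Fin n, fun ω => h (W i ω)) 2 μ := memLp_finsetSum' _ fun i _ => hL2 i
  have hsum0 : ∫ ω, (∑ i : Fin n, fun ω => h (W i ω)) ω ∂μ = 0 := by
    simp only [Finset.sum_apply]
    rw [integral_finsetSum _ fun i _ => (hL2 i).integrable one_le_two]
    simp [hint]
  have hvar := IndepFun.variance_sum (μ := μ) (s := Finset.univ)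
    (X := fun (i : Fin n) ω => h (W i ω)) (fun i _ => hL2 i) fun i _ j _ hij =>
      (hind.indepFun fun h => hij (Fin.ext h)).comp hm hm
  have h1 := hev _ hsum0
  simp only [Finset.sum_apply] at h1
  rw [← h1, ← hsum.ofReal_variance_eq, hvar, ENNReal.ofReal_sum_of_nonneg
    fun i _ => variance_nonneg _ _]
  have h3 : ∀ i : Fin n, ENNReal.ofReal (variance (fun ω => h (W i ω)) μ) =
      ∫⁻ x, ‖h x‖ₑ ^ 2 ∂F := fun i => by
    rw [(hL2 i).ofReal_variance_eq, hev _ (hint i), ← hF i, lintegral_map (by fun_prop) (hW i)]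
  simp [h3]

/-- The second moment of a sum of i.i.d. centred vectors `g(Wᵢ) z(Wᵢ)`. No moment condition is
needed, since the bound may be infinite. -/
lemma lintegral_enorm_sum_smul_sq_le {K : ℕ} (hW : ∀ i, Measurable (W i)) (hind : iIndepFun W μ)
    (hF : ∀ i, μ.map (W i) = F) {g : X → ℝ} (hg : Measurable g)
    {z : X → EuclideanSpace ℝ (Fin K)} (hz : Measurable z)
    (h0 : ∀ k, ∫ x, g x * z x k ∂F = 0) (n : ℕ) :
    ∫⁻ ω, ‖∑ i : Fin n, g (W i ω) • z (W i ω)‖ₑ ^ 2 ∂μ ≤ n * ∫⁻ x, ‖g x‖ₑ ^ 2 * ‖z x‖ₑ ^ 2 ∂F := by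
  have hm : ∀ k, Measurable fun x => g x * z x k := fun k => by fun_prop
  have e1 : ∫⁻ x, ‖g x‖ₑ ^ 2 * ‖z x‖ₑ ^ 2 ∂F = ∑ k, ∫⁻ x, ‖g x * z x k‖ₑ ^ 2 ∂F := by
    rw [← lintegral_finsetSum _ fun k _ => ((hm k).enorm.pow_const 2)]
    refine lintegral_congr fun x => ?_
    rw [EuclideanSpace.enorm_sq_eq_sum, Finset.mul_sum]
    exact Finset.sum_congr rfl fun k _ => by rw [enorm_mul, mul_pow]
  have e2 : ∫⁻ ω, ‖∑ i : Fin n, g (W i ω) • z (W i ω)‖ₑ ^ 2 ∂μ =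
      ∑ k, ∫⁻ ω, ‖∑ i : Fin n, g (W i ω) * z (W i ω) k‖ₑ ^ 2 ∂μ := by
    have hsm : ∀ k, Measurable fun ω => ∑ i : Fin n, g (W i ω) * z (W i ω) k := fun k =>
      Finset.measurable_sum _ fun i _ => (hm k).comp (hW i)
    rw [← lintegral_finsetSum _ fun k _ => (hsm k).enorm.pow_const 2]
    refine lintegral_congr fun ω => ?_
    rw [EuclideanSpace.enorm_sq_eq_sum]
    simp
  rw [e1, e2, Finset.mul_sum]
  refine Finset.sum_le_sum fun k _ => ?_
  by_cases hL2 : MemLp (fun x => g x * z x k) 2 F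
  · exact (lintegral_enorm_sum_sq hW hind hF (hm k) hL2 (h0 k) n).le
  · rcases n.eq_zero_or_pos with rfl | hn
    · simp
    have : ∫⁻ x, ‖g x * z x k‖ₑ ^ 2 ∂F = ∞ := by
      by_contra hne
      refine hL2 ⟨(hm k).aestronglyMeasurable, ?_⟩
      rw [eLpNorm_lt_top_iff_lintegral_rpow_enorm_lt_top two_ne_zero ENNReal.ofNat_ne_top]
      simpa using lt_top_iff_ne_top.2 hne
    rw [this, ENNReal.mul_top (by exact_mod_cast hn.ne')]
    exact le_top

end Independent

/-- Conditionally on `ℱ`, the errors `u i` have second moments at most `C` and are uncorrelated. The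
`ℱ`-measurable vectors `y i` need not have any moments: the second moment of `∑ u i • y i` is taken
over the `ℱ`-measurable event on which `∑ ‖y i‖²` is at most `τ`. -/
lemma setLIntegral_enorm_sum_smul_sq_le {Ω : Type*} [mΩ : MeasurableSpace Ω] {μ : Measure Ω}
    [IsProbabilityMeasure μ] {ℱ : MeasurableSpace Ω} (hℱ : ℱ ≤ mΩ) {n K : ℕ}
    {u : Fin n → Ω → ℝ} (hu : ∀ i, MemLp (u i) 2 μ)
    {y : Fin n → Ω → EuclideanSpace ℝ (Fin K)} (hy : ∀ i, Measurable[ℱ] (y i))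
    {C : ℝ} (hC : 0 ≤ C) (hvar : ∀ i, μ[fun ω => u i ω ^ 2 | ℱ] ≤ᵐ[μ] fun _ => C)
    (hcov : ∀ i j, i ≠ j → μ[fun ω => u i ω * u j ω | ℱ] =ᵐ[μ] 0) (τ : ℝ) :
    ∫⁻ ω in {ω | ∑ i, ‖y i ω‖ ^ 2 ≤ τ}, ‖∑ i, u i ω • y i ω‖ₑ ^ 2 ∂μ ≤ ENNReal.ofReal (C * τ) := by
  classical
  rcases lt_or_ge τ 0 with hτ | hτ
  · have : {ω | ∑ i, ‖y i ω‖ ^ 2 ≤ τ} = ∅ := by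
      ext ω
      simpa using hτ.trans_le (Finset.sum_nonneg fun i _ => sq_nonneg ‖y i ω‖)
    simp [this]
  set A : Set Ω := {ω | ∑ i, ‖y i ω‖ ^ 2 ≤ τ} with hAdef
  have hA : MeasurableSet[ℱ] A := by
    have hN : Measurable[ℱ] fun ω => ∑ i, ‖y i ω‖ ^ 2 :=
      Finset.measurable_sum _ fun i _ => (hy i).norm.pow_const 2
    exact hN measurableSet_Iic
  set g : Fin n → Fin n → Ω → ℝ := fun i j => A.indicator fun ω => inner ℝ (y i ω) (y j ω) with hg
  have hgm : ∀ i j, StronglyMeasurable[ℱ] (g i j) := fun i j =>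
    ((hy i).inner (hy j)).stronglyMeasurable.indicator hA
  have hnorm : ∀ ω ∈ A, ∀ i, ‖y i ω‖ ^ 2 ≤ τ := fun ω hω i =>
    (Finset.single_le_sum (f := fun i => ‖y i ω‖ ^ 2) (fun _ _ => sq_nonneg _)
      (Finset.mem_univ i)).trans hω
  have hgb : ∀ i j ω, ‖g i j ω‖ ≤ τ := fun i j ω => by
    by_cases hω : ω ∈ A
    · simp only [hg, Set.indicator_of_mem hω]
      refine (norm_inner_le_norm _ _).trans ?_
      nlinarith [hnorm ω hω i, hnorm ω hω j, sq_nonneg (‖y i ω‖ - ‖y j ω‖)]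
    · simpa [hg, Set.indicator_of_notMem hω] using hτ
  have huu : ∀ i j, Integrable (fun ω => u i ω * u j ω) μ := fun i j => (hu i).integrable_mul (hu j)
  have hguu : ∀ i j, Integrable (fun ω => g i j ω * (u i ω * u j ω)) μ := fun i j =>
    (huu i j).bdd_mul ((hgm i j).mono hℱ).aestronglyMeasurable (ae_of_all _ (hgb i j))
  have hgint : ∀ i j, Integrable (g i j) μ := fun i j =>
    Integrable.of_bound ((hgm i j).mono hℱ).aestronglyMeasurable τ (ae_of_all _ (hgb i j))
  -- pull the `ℱ`-measurable factor out of the conditional expectation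
  have hpull : ∀ i j, ∫ ω, g i j ω * (u i ω * u j ω) ∂μ =
      ∫ ω, g i j ω * μ[fun ω => u i ω * u j ω | ℱ] ω ∂μ := fun i j => by
    rw [← integral_condExp hℱ]
    exact integral_congr_ae
      (condExp_mul_of_stronglyMeasurable_left (hgm i j) (hguu i j) (huu i j))
  have hoff : ∀ i j, i ≠ j → ∫ ω, g i j ω * (u i ω * u j ω) ∂μ = 0 := fun i j hij => by
    rw [hpull, integral_eq_zero_of_ae]
    filter_upwards [hcov i j hij] with ω hω
    simp [hω]
  have hdiag : ∀ i, ∫ ω, g i i ω * (u i ω * u i ω) ∂μ ≤ ∫ ω, g i i ω * C ∂μ := fun i => by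
    rw [hpull]
    refine integral_mono_ae ?_ ((hgint i i).mul_const C) ?_
    · exact integrable_condExp.bdd_mul ((hgm i i).mono hℱ).aestronglyMeasurable
        (ae_of_all _ (hgb i i))
    · filter_upwards [hvar i] with ω hω
      simp only [sq] at hω
      refine mul_le_mul_of_nonneg_left hω ?_
      exact Set.indicator_nonneg (fun ω _ => real_inner_self_nonneg) ω
  have hexp : ∀ ω, A.indicator (fun ω => ‖∑ i, u i ω • y i ω‖ ^ 2) ω =
      ∑ i, ∑ j, g i j ω * (u i ω * u j ω) := fun ω => by
    by_cases hω : ω ∈ A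
    · simp only [hg, Set.indicator_of_mem hω]
      rw [← real_inner_self_eq_norm_sq, sum_inner]
      refine Finset.sum_congr rfl fun i _ => ?_
      rw [inner_sum]
      refine Finset.sum_congr rfl fun j _ => ?_
      rw [real_inner_smul_left, real_inner_smul_right]
      ring
    · simp [hg, Set.indicator_of_notMem hω]
  have hreal : ∫ ω, A.indicator (fun ω => ‖∑ i, u i ω • y i ω‖ ^ 2) ω ∂μ ≤ C * τ := by
    simp only [hexp]
    rw [integral_finsetSum _ fun i _ => integrable_finsetSum _ fun j _ => hguu i j]
    have h1 : ∀ i, ∫ ω, ∑ j, g i j ω * (u i ω * u j ω) ∂μ ≤ ∫ ω, g i i ω * C ∂μ := fun i => by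
      rw [integral_finsetSum _ fun j _ => hguu i j, Finset.sum_eq_single i
        (fun j _ hj => hoff i j hj.symm) (by simp)]
      exact hdiag i
    refine (Finset.sum_le_sum fun i _ => h1 i).trans ?_
    rw [← integral_finsetSum _ fun i _ => (hgint i i).mul_const C]
    have h2 : ∀ ω, ∑ i, g i i ω * C ≤ C * τ := fun ω => by
      rw [← Finset.sum_mul, mul_comm]
      refine mul_le_mul_of_nonneg_left ?_ hC
      by_cases hω : ω ∈ A
      · simp only [hg, Set.indicator_of_mem hω, real_inner_self_eq_norm_sq]
        exact hω
      · simpa [hg, Set.indicator_of_notMem hω] using hτ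
    refine (integral_mono (integrable_finsetSum _ fun i _ => (hgint i i).mul_const C)
      (integrable_const (C * τ)) h2).trans_eq ?_
    simp
  rw [← lintegral_indicator (hℱ _ hA)]
  have h3 : ∀ ω, A.indicator (fun ω => ‖∑ i, u i ω • y i ω‖ₑ ^ 2) ω =
      ENNReal.ofReal (A.indicator (fun ω => ‖∑ i, u i ω • y i ω‖ ^ 2) ω) := fun ω => by
    by_cases hω : ω ∈ A
    · simp only [Set.indicator_of_mem hω]
      rw [ENNReal.ofReal_pow (norm_nonneg _), ofReal_norm]
    · simp [Set.indicator_of_notMem hω]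
  simp only [h3]
  rw [← ofReal_integral_eq_lintegral_ofReal]
  · exact ENNReal.ofReal_le_ofReal hreal
  · rw [funext hexp]
    exact integrable_finsetSum _ fun i _ => integrable_finsetSum _ fun j _ => hguu i j
  · exact ae_of_all _ fun ω => Set.indicator_nonneg (fun ω _ => sq_nonneg _) ω

/-! ### The sample Gram matrix of the whitened basis -/

namespace SeriesLS

section LowGram

variable {Ω X : Type*} {K : ℕ}

/-- The event that the sample Gram matrix `n⁻¹ ∑ᵢ z(Wᵢ) z(Wᵢ)ᵀ` of the first `n` observations has
an eigenvalue below `1 / 2`. -/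
def lowGram (z : X → EuclideanSpace ℝ (Fin K)) (W : ℕ → Ω → X) (n : ℕ) : Set Ω :=
  {ω | ∃ v, ∑ i : Fin n, inner ℝ (z (W i ω)) v ^ 2 < n / 2 * ‖v‖ ^ 2}

variable [MeasurableSpace Ω] [MeasurableSpace X] {μ : Measure Ω} [IsProbabilityMeasure μ]
  {W : ℕ → Ω → X} {F : Measure X} {z : X → EuclideanSpace ℝ (Fin K)}

/-- The matrix Chernoff bound for bounded isotropic regressors. -/
lemma measure_lowGram_le (hK : 1 ≤ K) (hW : ∀ i, Measurable (W i)) (hind : iIndepFun W μ)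
    (hF : ∀ i, μ.map (W i) = F) (hz : Measurable z)
    (hiso : ∀ j k, ∫ x, z x j * z x k ∂F = if j = k then 1 else 0)
    {L : ℝ} (hL : 0 < L) (hbd : ∀ᵐ x ∂F, ‖z x‖ ^ 2 ≤ L) (n : ℕ) :
    μ (lowGram z W n) ≤ ENNReal.ofReal (K * Real.exp (-(n / (10 * L)))) := by
  have : Nonempty (Fin K) := ⟨⟨0, hK⟩⟩
  have hz' : Measurable fun x => (z x).ofLp := by fun_prop
  have hsq : ∀ v : EuclideanSpace ℝ (Fin K), v.ofLp ⬝ᵥ v.ofLp = ‖v‖ ^ 2 := fun v => by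
    rw [EuclideanSpace.real_norm_sq_eq]
    exact Finset.sum_congr rfl fun k _ => (sq _).symm
  have h := measureReal_exists_sum_dotProduct_sq_lt_le (μ := μ) (Z := fun i ω => (z (W i ω)).ofLp)
    (fun i => hz'.comp (hW i)) (hind.comp _ fun _ => hz') (fun i j k => by
      rw [← hiso j k, ← hF i, integral_map (hW i).aemeasurable]
      exact Measurable.aestronglyMeasurable (by fun_prop)) hL (fun i => by
      simp only [hsq]
      rw [← hF i] at hbd
      exact ae_of_ae_map (hW i).aemeasurable hbd) n
  rw [Fintype.card_fin] at h
  rw [← ENNReal.ofReal_toReal (measure_ne_top μ (lowGram z W n))]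
  refine ENNReal.ofReal_le_ofReal (le_trans ?_ h)
  refine measureReal_mono ?_
  rintro ω ⟨v, hv⟩
  refine ⟨v.ofLp, ?_⟩
  rw [hsq, Finset.sum_range (fun i => ((z (W i ω)).ofLp ⬝ᵥ v.ofLp) ^ 2)]
  refine (le_of_eq ?_).trans_lt hv
  refine Finset.sum_congr rfl fun i _ => ?_
  rw [EuclideanSpace.inner_eq_star_dotProduct, dotProduct_comm]
  rfl

/-- For a single regressor the law of large numbers suffices, without any boundedness. -/
lemma tendsto_measure_lowGram_one {z : X → EuclideanSpace ℝ (Fin 1)} (hW : ∀ i, Measurable (W i))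
    (hind : iIndepFun W μ) (hF : ∀ i, μ.map (W i) = F) (hz : Measurable z)
    (hiso : ∫ x, z x 0 * z x 0 ∂F = 1) :
    Tendsto (fun n => μ (lowGram z W n)) atTop (𝓝 0) := by
  have hm : Measurable fun x => z x 0 * z x 0 := by fun_prop
  have hmean : ∫ ω, z (W 0 ω) 0 * z (W 0 ω) 0 ∂μ = 1 := by
    rw [← hiso, ← hF 0, integral_map (hW 0).aemeasurable hm.aestronglyMeasurable]
  have hint : Integrable (fun ω => z (W 0 ω) 0 * z (W 0 ω) 0) μ := by
    by_contra h
    rw [integral_undef h] at hmean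
    exact zero_ne_one hmean
  have hlln := strong_law_ae_real (fun i ω => z (W i ω) 0 * z (W i ω) 0) hint
    (fun i j hij => (hind.indepFun hij).comp hm hm)
    (fun i => IdentDistrib.comp ⟨(hW i).aemeasurable, (hW 0).aemeasurable, by rw [hF, hF]⟩ hm)
  rw [hmean] at hlln
  have hmeas : ∀ n : ℕ, AEStronglyMeasurable
      (fun ω => (∑ i ∈ Finset.range n, z (W i ω) 0 * z (W i ω) 0) / n) μ := fun n =>
    ((Finset.measurable_sum _ fun i _ => hm.comp (hW i)).div_const _).aestronglyMeasurable
  have htm := tendstoInMeasure_of_tendsto_ae hmeas hlln (ENNReal.ofReal (1 / 2)) (by simp)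
  refine tendsto_of_tendsto_of_tendsto_of_le_of_le' tendsto_const_nhds htm
    (.of_forall fun _ => zero_le) ((eventually_gt_atTop 0).mono fun n hn => measure_mono ?_)
  rintro ω ⟨v, hv⟩
  have hn' : (0 : ℝ) < n := by exact_mod_cast hn
  have e1 : ∀ y : EuclideanSpace ℝ (Fin 1), inner ℝ y v ^ 2 = y 0 * y 0 * v 0 ^ 2 := fun y => by
    simp [PiLp.inner_apply]; ring
  simp only [e1, EuclideanSpace.real_norm_sq_eq, Finset.univ_unique, Fin.default_eq_zero,
    Finset.sum_singleton] at hv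
  rw [← Finset.sum_mul] at hv
  have h2 := lt_of_mul_lt_mul_right hv (sq_nonneg _)
  rw [← Finset.sum_range (fun i => z (W i ω) 0 * z (W i ω) 0)] at h2
  have h3 : (∑ i ∈ Finset.range n, z (W i ω) 0 * z (W i ω) 0) / n ≤ 1 / 2 := by
    rw [div_le_iff₀ hn']; linarith
  change ENNReal.ofReal (1 / 2) ≤ edist _ _
  rw [edist_dist]
  refine ENNReal.ofReal_le_ofReal ?_
  rw [Real.dist_eq, abs_sub_comm]
  exact le_trans (by linarith) (le_abs_self _)

end LowGram

/-- The sample Gram matrix of the whitened basis is bounded below with probability tending to one.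
If `K = 1`, the logarithm vanishes and the rate condition says nothing; but then the basis is the
same for all such `n`. -/
lemma tendsto_measure_lowGram {Ω : Type*} [MeasurableSpace Ω] {μ : Measure Ω}
    [IsProbabilityMeasure μ] {d : ℕ} {W : ℕ → Ω → EuclideanSpace ℝ (Fin d)}
    {F : Measure (EuclideanSpace ℝ (Fin d))}
    (hW : ∀ i, Measurable (W i)) (hind : iIndepFun W μ) (hF : ∀ i, μ.map (W i) = F)
    {p : (K : ℕ) → EuclideanSpace ℝ (Fin d) → EuclideanSpace ℝ (Fin K)}
    (hp : ∀ K, Measurable (p K)) {K : ℕ → ℕ} (hK : ∀ n, 1 ≤ K n)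
    (hp2 : ∀ n, MemLp (p (K n)) 2 F) (hlam : ∀ n, 0 < lambdaMin (gram F (p (K n))))
    {L : ℕ → ℝ≥0∞} (hL : ∀ n, ∀ᵐ w ∂F, ‖whiten F (p (K n)) w‖ₑ ^ 2 ≤ L n)
    (hrate : Tendsto (fun n : ℕ => L n * ENNReal.ofReal (Real.log (K n)) / (n : ℝ≥0∞))
      atTop (𝓝 0)) :
    Tendsto (fun n => μ (lowGram (whiten F (p (K n))) W n)) atTop (𝓝 0) := by
  rw [ENNReal.tendsto_nhds_zero]
  intro ε hε
  have hone : ∀ᶠ n in atTop, K n = 1 → μ (lowGram (whiten F (p (K n))) W n) ≤ ε := by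
    by_cases h : ∃ n, K n = 1
    · obtain ⟨m, hm⟩ := h
      have h2 : MemLp (p 1) 2 F := by
        have h := hp2 m
        rwa [hm] at h
      have hl : 0 < lambdaMin (gram F (p 1)) := by
        have h := hlam m
        rwa [hm] at h
      have ht := tendsto_measure_lowGram_one hW hind hF (measurable_whiten (F := F) (hp 1))
        (by rw [integral_whiten_mul_whiten h2 hl, if_pos rfl])
      filter_upwards [ENNReal.tendsto_nhds_zero.1 ht ε hε] with n hn hKn
      rwa [hKn]
    · exact .of_forall fun n hn => absurd ⟨n, hn⟩ h
  have htwo : ∀ᶠ n in atTop, 2 ≤ K n → μ (lowGram (whiten F (p (K n))) W n) ≤ ε := by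
    -- choose `t` with `2 ^ (-t) ≤ ε`
    obtain ⟨t, ht0, ht⟩ : ∃ t : ℝ, 0 < t ∧ ENNReal.ofReal (Real.exp (-(t * Real.log 2))) ≤ ε := by
      have h1 : Tendsto (fun t : ℝ => ENNReal.ofReal (Real.exp (-(t * Real.log 2)))) atTop
          (𝓝 0) := by
        rw [← ENNReal.ofReal_zero]
        refine ENNReal.tendsto_ofReal (Real.tendsto_exp_neg_atTop_nhds_zero.comp ?_)
        exact tendsto_id.atTop_mul_const (Real.log_pos one_lt_two)
      exact ((eventually_gt_atTop 0).and (ENNReal.tendsto_nhds_zero.1 h1 ε hε)).exists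
    have hη : 0 < 1 / (10 * (t + 1)) := by positivity
    filter_upwards [ENNReal.tendsto_nhds_zero.1 hrate (ENNReal.ofReal (1 / (10 * (t + 1))))
      (by simpa using hη), eventually_gt_atTop 0] with n hn hn0 hKn
    have hn' : (0 : ℝ) < n := by exact_mod_cast hn0
    have hKr : (2 : ℝ) ≤ K n := by exact_mod_cast hKn
    have hlog2 : Real.log 2 ≤ Real.log (K n) := Real.log_le_log two_pos hKr
    have hlog : 0 < Real.log (K n) := (Real.log_pos one_lt_two).trans_le hlog2
    -- the largest bound on the squared length that the rate condition leaves possible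
    set L' : ℝ := n * (1 / (10 * (t + 1))) / Real.log (K n) with hL'
    have hL'0 : 0 < L' := by positivity
    have hLL : L n ≤ ENNReal.ofReal L' := by
      rw [hL', ENNReal.ofReal_div_of_pos hlog, ENNReal.ofReal_mul hn'.le, ENNReal.ofReal_natCast]
      rw [ENNReal.le_div_iff_mul_le (by simp [hlog]) (by simp)]
      rw [mul_comm (n : ℝ≥0∞)]
      exact (ENNReal.div_le_iff_le_mul (by simp [hn0.ne']) (by simp)).1 hn
    have hbd : ∀ᵐ w ∂F, ‖whiten F (p (K n)) w‖ ^ 2 ≤ L' := by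
      filter_upwards [hL n] with w hw
      have h1 := hw.trans hLL
      rwa [← ofReal_norm, ← ENNReal.ofReal_pow (norm_nonneg _),
        ENNReal.ofReal_le_ofReal_iff hL'0.le] at h1
    refine (measure_lowGram_le (hK n) hW hind hF (measurable_whiten (hp _))
      (integral_whiten_mul_whiten (hp2 n) (hlam n)) hL'0 hbd n).trans (le_trans ?_ ht)
    refine ENNReal.ofReal_le_ofReal ?_
    have e1 : (n : ℝ) / (10 * L') = (t + 1) * Real.log (K n) := by
      rw [hL']; field_simp
    have e2 : (K n : ℝ) = Real.exp (Real.log (K n)) := (Real.exp_log (by linarith)).symm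
    rw [e1]
    nth_rewrite 1 [e2]
    rw [← Real.exp_add]
    refine Real.exp_le_exp.2 ?_
    nlinarith
  filter_upwards [hone, htwo] with n h1 h2
  rcases (hK n).eq_or_lt with h | h
  · exact h1 h.symm
  · exact h2 h

end SeriesLS

/-! ### The estimation error on a good sample -/

namespace SeriesLS

section Population

variable {d K : ℕ} {F : Measure (EuclideanSpace ℝ (Fin d))}
  {q : EuclideanSpace ℝ (Fin d) → EuclideanSpace ℝ (Fin K)}

lemma integral_inner_whiten_sq (hq2 : MemLp q 2 F) (hpos : 0 < lambdaMin (gram F q))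
    (v : EuclideanSpace ℝ (Fin K)) : ∫ w, inner ℝ (whiten F q w) v ^ 2 ∂F = ‖v‖ ^ 2 := by
  have hz := memLp_whiten_apply hq2
  have hint : ∀ j k, Integrable (fun w => v j * v k * (whiten F q w j * whiten F q w k)) F :=
    fun j k => ((hz j).integrable_mul (hz k)).const_mul _
  have e : ∀ w, inner ℝ (whiten F q w) v ^ 2 =
      ∑ j, ∑ k, v j * v k * (whiten F q w j * whiten F q w k) := fun w => by
    rw [sq, PiLp.inner_apply, Finset.sum_mul_sum]
    refine Finset.sum_congr rfl fun j _ => Finset.sum_congr rfl fun k _ => ?_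
    simp only [RCLike.inner_apply, conj_trivial]
    ring
  simp only [e]
  rw [integral_finsetSum _ fun j _ => integrable_finsetSum _ fun k _ => hint j k,
    EuclideanSpace.real_norm_sq_eq]
  refine Finset.sum_congr rfl fun j _ => ?_
  rw [integral_finsetSum _ fun k _ => hint j k]
  simp only [integral_const_mul, integral_whiten_mul_whiten hq2 hpos]
  simp [sq]

lemma memLp_lin (hq2 : MemLp q 2 F) (b : EuclideanSpace ℝ (Fin K)) : MemLp (lin q b) 2 F :=
  memLp_finsetSum _ fun j _ => (hq2.eval_piLp j).mul_const _

lemma measurable_lin (hq : Measurable q) (b : EuclideanSpace ℝ (Fin K)) : Measurable (lin q b) :=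
  Finset.measurable_sum _ fun j _ => Measurable.mul_const (by fun_prop) _

/-- The `L²` distance of two linear combinations is the Euclidean distance of their coefficients in
the whitened basis. -/
lemma sqL2_lin_sub_lin (hq2 : MemLp q 2 F) (hpos : 0 < lambdaMin (gram F q))
    (b c : EuclideanSpace ℝ (Fin K)) :
    sqL2 F (fun w => lin q b w - lin q c w) = ENNReal.ofReal (‖whitenCoef F q (b - c)‖ ^ 2) := by
  rw [← integral_inner_whiten_sq hq2 hpos, ofReal_integral_eq_lintegral_ofReal]
  · refine lintegral_congr fun w => ?_
    rw [inner_whiten_whitenCoef hpos, lin_sub, ← enorm_pow, Real.enorm_of_nonneg (sq_nonneg _)]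
  · simp only [inner_whiten_whitenCoef hpos]
    exact (memLp_lin hq2 _).integrable_sq
  · exact ae_of_all _ fun w => sq_nonneg _

/-- The expected squared length of the whitened basis is the number of basis functions. -/
lemma lintegral_enorm_whiten_sq (hq2 : MemLp q 2 F) (hpos : 0 < lambdaMin (gram F q)) :
    ∫⁻ w, ‖whiten F q w‖ₑ ^ 2 ∂F = K := by
  have hz := memLp_whiten_apply hq2
  simp only [EuclideanSpace.enorm_sq_eq_sum]
  rw [lintegral_finsetSum' _ fun k _ => (hz k).1.enorm.pow_const 2]
  have h : ∀ k, ∫⁻ w, ‖whiten F q w k‖ₑ ^ 2 ∂F = 1 := fun k => by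
    have h1 := integral_whiten_mul_whiten hq2 hpos k k
    rw [if_pos rfl] at h1
    have hi : Integrable (fun w => whiten F q w k * whiten F q w k) F :=
      (hz k).integrable_mul (hz k)
    rw [← ENNReal.ofReal_one, ← h1, ofReal_integral_eq_lintegral_ofReal hi
      (ae_of_all _ fun w => mul_self_nonneg _)]
    refine lintegral_congr fun w => ?_
    rw [← enorm_pow, Real.enorm_of_nonneg (sq_nonneg _), sq]
  simp [h]

end Population

section GoodSample

variable {d n K : ℕ} {F : Measure (EuclideanSpace ℝ (Fin d))}
  {q : EuclideanSpace ℝ (Fin d) → EuclideanSpace ℝ (Fin K)}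

lemma Bn_nonneg (w x : Fin n → EuclideanSpace ℝ (Fin d)) : 0 ≤ Bn F q w x := by
  rw [Bn]; positivity

lemma ofReal_div_le_of_le_mul {a : ℝ} {b : ℝ≥0∞} (hn : 0 < n) (h : ENNReal.ofReal a ≤ n * b) :
    ENNReal.ofReal (a / n) ≤ b := by
  rw [ENNReal.ofReal_div_of_pos (by exact_mod_cast hn), ENNReal.ofReal_natCast]
  exact ENNReal.div_le_of_le_mul' h

lemma ofReal_sum_sq_le {a : Fin n → ℝ} {t : ℝ≥0∞} (h : ∀ i, ‖a i‖ₑ ≤ t) :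
    ENNReal.ofReal (∑ i, a i ^ 2) ≤ n * t ^ 2 := by
  rw [ENNReal.ofReal_sum_of_nonneg fun _ _ => sq_nonneg _]
  refine (Finset.sum_le_card_nsmul _ _ (t ^ 2) fun i _ => ?_).trans_eq (by simp)
  rw [← Real.enorm_of_nonneg (sq_nonneg _), enorm_pow]
  exact pow_le_pow_left' (h i) 2

/-- Both rates for a given sample, with explicit constants: the deterministic part of the argument.
The stochastic terms enter through the hypotheses `hu`, `he` and `hez`. -/
lemma sqL2_lin_sub_lin_le (hn : 0 < n) (hq2 : MemLp q 2 F) (hpos : 0 < lambdaMin (gram F q))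
    {ψ : EuclideanSpace ℝ (Fin d) → ℝ} {y : Fin n → ℝ} {w x : Fin n → EuclideanSpace ℝ (Fin d)}
    {b bhat : EuclideanSpace ℝ (Fin K)} (hmin : IsMinOn (lsLoss q y x) Set.univ bhat)
    (hgram : ∀ v, n / 2 * ‖v‖ ^ 2 ≤ ∑ i, inner ℝ (whiten F q (w i)) v ^ 2)
    (hB : Bn F q w x ≤ 1 / 16) {M C V : ℝ≥0} (hM : 1 ≤ M) (hV : ‖whitenCoef F q b‖ ^ 2 ≤ V)
    (hu : ‖∑ i, (y i - ψ (w i)) • whiten F q (x i)‖ ^ 2 ≤ C * (n * K))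
    {ξ η ϑ : ℝ≥0∞} (he : ENNReal.ofReal (∑ i, (ψ (w i) - lin q b (w i)) ^ 2) ≤ M * (n * ξ))
    (hez : ENNReal.ofReal (‖∑ i, (ψ (w i) - lin q b (w i)) • whiten F q (w i)‖ ^ 2) ≤ M * (n * η))
    (hϑw : ∀ i, ‖ψ (w i) - lin q b (w i)‖ₑ ≤ ϑ) (hϑx : ∀ i, ‖ψ (x i) - lin q b (x i)‖ₑ ≤ ϑ)
    {B m : ℝ≥0∞} (hBdef : B = ENNReal.ofReal (Bn F q w x))
    (hm : m = min (B + ξ) (ENNReal.ofReal (Rn ψ w x) + ϑ ^ 2)) :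
    sqL2 F (fun w => lin q bhat w - lin q b w) ≤
        (512 * (C + M + V + 1) : ℝ≥0) * ((K : ℝ≥0∞) / n + m) ∧
      sqL2 F (fun w => lin q bhat w - lin q b w) ≤
        (512 * (C + M + V + 1) : ℝ≥0) * ((K : ℝ≥0∞) / n + (B + B * m + η / n)) := by
  have hn' : (0 : ℝ) < n := by exact_mod_cast hn
  rw [sqL2_lin_sub_lin hq2 hpos]
  set z := whiten F q
  set γ := whitenCoef F q b
  set δ := whitenCoef F q (bhat - b)
  set e : Fin n → ℝ := fun i => ψ (w i) - lin q b (w i)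
  set u : Fin n → ℝ := fun i => y i - ψ (w i)
  set β := Bn F q w x
  have hβ0 : 0 ≤ β := Bn_nonneg w x
  have hxy := sum_inner_whiten_sub_sq_le (F := F) (q := q) hn w x
  have hδ : ∑ i, inner ℝ (z (x i)) δ ^ 2 =
      ∑ i, inner ℝ (z (x i)) δ * (u i + (e i + inner ℝ (z (w i) - z (x i)) γ)) := by
    have h := sum_mul_lin_eq_zero hn hmin (bhat - b)
    rw [← sub_eq_zero, ← Finset.sum_sub_distrib, ← neg_eq_zero, ← Finset.sum_neg_distrib, ← h]
    refine Finset.sum_congr rfl fun i _ => ?_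
    simp only [z, γ, δ, u, e, inner_sub_left, inner_whiten_whitenCoef hpos, lin_sub]
    ring
  have h1 := norm_sq_le_of_normal_eq hn hB hgram hxy hδ
  have h2 := norm_sq_le_of_normal_eq' hn hβ0 hB hgram hxy hδ
  -- the stochastic term
  have hU : ENNReal.ofReal (‖∑ i, u i • z (x i)‖ ^ 2 / n ^ 2) ≤ C * ((K : ℝ≥0∞) / n) := by
    have e1 : (C : ℝ≥0∞) * ((K : ℝ≥0∞) / n) = ENNReal.ofReal (C * (K / n)) := by
      rw [ENNReal.ofReal_mul C.coe_nonneg, ENNReal.ofReal_div_of_pos hn', ENNReal.ofReal_natCast,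
        ENNReal.ofReal_natCast, ENNReal.ofReal_coe_nnreal]
    rw [e1]
    refine ENNReal.ofReal_le_ofReal ?_
    rw [div_le_iff₀ (by positivity)]
    refine hu.trans_eq ?_
    field_simp
  -- the approximation errors
  have hE : ENNReal.ofReal ((∑ i, e i ^ 2) / n) ≤ M * ξ :=
    ofReal_div_le_of_le_mul hn (he.trans_eq (by ring))
  have hEϑ : ENNReal.ofReal ((∑ i, e i ^ 2) / n) ≤ ϑ ^ 2 :=
    ofReal_div_le_of_le_mul hn (ofReal_sum_sq_le hϑw)
  have hM' : (1 : ℝ≥0∞) ≤ M := by exact_mod_cast hM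
  have hEm : ENNReal.ofReal ((∑ i, e i ^ 2) / n) ≤ M * m := by
    rw [hm]
    rcases min_choice (B + ξ) (ENNReal.ofReal (Rn ψ w x) + ϑ ^ 2) with h | h <;> rw [h]
    · exact hE.trans (mul_le_mul_right le_add_self _)
    · exact hEϑ.trans (le_add_self.trans (le_mul_of_one_le_left zero_le hM'))
  have hEz : ENNReal.ofReal (‖∑ i, e i • z (w i)‖ ^ 2 / n ^ 2) ≤ M * (η / n) := by
    rw [sq (n : ℝ), ← div_div]
    refine ofReal_div_le_of_le_mul hn (ofReal_div_le_of_le_mul hn (hez.trans_eq ?_))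
    have hnn : (n : ℝ≥0∞) * (η / n) = η :=
      ENNReal.mul_div_cancel (by exact_mod_cast hn.ne') (by simp)
    calc (M : ℝ≥0∞) * (n * η) = M * (n * (n * (η / n))) := by rw [hnn]
      _ = _ := by ring
  have hr : ENNReal.ofReal ((∑ i, (e i + inner ℝ (z (w i) - z (x i)) γ) ^ 2) / n) ≤
      (2 * (M + V + 1) : ℝ≥0) * m := by
    set S := ∑ i, (e i + inner ℝ (z (w i) - z (x i)) γ) ^ 2
    have hS1 : S / n ≤ 2 * ((∑ i, e i ^ 2) / n) + 2 * (β * V) := by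
      have h3 : S ≤ 2 * ∑ i, e i ^ 2 + 2 * ∑ i, inner ℝ (z (w i) - z (x i)) γ ^ 2 := by
        rw [Finset.mul_sum, Finset.mul_sum, ← Finset.sum_add_distrib]
        exact Finset.sum_le_sum fun i _ => by
          nlinarith [sq_nonneg (e i - inner ℝ (z (w i) - z (x i)) γ)]
      have h4 : n * β * ‖γ‖ ^ 2 ≤ n * β * V := by gcongr
      have h5 := hxy γ
      rw [div_le_iff₀ hn']
      have e1 : (2 * ((∑ i, e i ^ 2) / n) + 2 * (β * V)) * n =
          2 * ∑ i, e i ^ 2 + 2 * (n * β * V) := by field_simp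
      rw [e1]
      linarith
    have hS2 : S / n ≤ 2 * Rn ψ w x + 2 * ((∑ i, (ψ (x i) - lin q b (x i)) ^ 2) / n) := by
      rw [Rn, ← mul_div_assoc, ← mul_div_assoc, ← add_div]
      refine div_le_div_of_nonneg_right ?_ hn'.le
      rw [Finset.mul_sum, Finset.mul_sum, ← Finset.sum_add_distrib]
      refine Finset.sum_le_sum fun i _ => ?_
      simp only [e, z, γ, inner_sub_left, inner_whiten_whitenCoef hpos]
      nlinarith [sq_nonneg ((ψ (w i) - ψ (x i)) - (ψ (x i) - lin q b (x i)))]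
    have h6 : (2 : ℝ≥0∞) * M ≤ (2 * (M + V + 1) : ℝ≥0) := by
      have : 2 * M ≤ 2 * (M + V + 1) := by gcongr; rw [add_assoc]; exact le_self_add
      exact_mod_cast this
    have h7 : (2 : ℝ≥0∞) * V ≤ (2 * (M + V + 1) : ℝ≥0) := by
      have : 2 * V ≤ 2 * (M + V + 1) := by
        gcongr; rw [add_assoc, add_left_comm]; exact le_self_add
      exact_mod_cast this
    have h8 : (2 : ℝ≥0∞) ≤ (2 * (M + V + 1) : ℝ≥0) := by
      have : 2 * 1 ≤ 2 * (M + V + 1) := by gcongr; exact le_add_self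
      rw [mul_one] at this
      exact_mod_cast this
    have hR0 : 0 ≤ Rn ψ w x := by rw [Rn]; positivity
    rw [hm]
    rcases min_choice (B + ξ) (ENNReal.ofReal (Rn ψ w x) + ϑ ^ 2) with h | h <;> rw [h]
    · refine (ENNReal.ofReal_le_ofReal hS1).trans ?_
      rw [ENNReal.ofReal_add (by positivity) (by positivity), ENNReal.ofReal_mul two_pos.le,
        ENNReal.ofReal_mul two_pos.le, ENNReal.ofReal_mul hβ0, ENNReal.ofReal_ofNat,
        ENNReal.ofReal_coe_nnreal, ← hBdef, add_comm, mul_add]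
      refine add_le_add ?_ ?_
      · rw [mul_comm B, ← mul_assoc]
        exact mul_le_mul_left h7 _
      · refine (mul_le_mul_right hE _).trans ?_
        rw [← mul_assoc]
        exact mul_le_mul_left h6 _
    · refine (ENNReal.ofReal_le_ofReal hS2).trans ?_
      rw [ENNReal.ofReal_add (by positivity) (by positivity), ENNReal.ofReal_mul two_pos.le,
        ENNReal.ofReal_mul two_pos.le, ENNReal.ofReal_ofNat, mul_add]
      refine add_le_add (mul_le_mul_left h8 _) (mul_le_mul' h8 ?_)
      exact ofReal_div_le_of_le_mul hn (ofReal_sum_sq_le hϑx)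
  set c : ℝ≥0 := 512 * (C + M + V + 1) with hc
  have cast_le : ∀ (a : ℝ≥0), a ≤ c → ∀ t : ℝ≥0∞, (a : ℝ≥0∞) * t ≤ c * t := fun a ha t =>
    mul_le_mul_left (by exact_mod_cast ha) t
  have hcC : 256 * C ≤ c := by
    rw [hc, add_assoc, add_assoc]
    exact mul_le_mul' (by norm_num) le_self_add
  have hcM : 256 * M ≤ c := by
    rw [hc, add_right_comm C, add_right_comm _ M, add_comm _ M]
    exact mul_le_mul' (by norm_num) le_self_add
  have hcV : 256 * V ≤ c := by
    rw [hc, add_right_comm _ V, add_comm _ V]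
    exact mul_le_mul' (by norm_num) le_self_add
  have hcMV : 256 * (2 * (M + V + 1)) ≤ c := by
    have : 256 * (2 * (M + V + 1)) = 512 * (M + V + 1) := by ring
    rw [hc, this, add_assoc C, add_assoc C]
    exact mul_le_mul' le_rfl le_add_self
  constructor
  · refine (ENNReal.ofReal_le_ofReal h1).trans ?_
    rw [ENNReal.ofReal_mul (by norm_num), ENNReal.ofReal_add (by positivity) (by positivity),
      ENNReal.ofReal_ofNat, mul_add, mul_add]
    refine add_le_add ((mul_le_mul_right hU _).trans ?_) ((mul_le_mul_right hr _).trans ?_)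
    · simpa [mul_assoc] using cast_le _ hcC ((K : ℝ≥0∞) / n)
    · simpa [mul_assoc] using cast_le _ hcMV m
  · refine (ENNReal.ofReal_le_ofReal h2).trans ?_
    have hβV : ENNReal.ofReal (β * ‖γ‖ ^ 2) ≤ V * B := by
      rw [ENNReal.ofReal_mul hβ0, ← hBdef, mul_comm]
      refine mul_le_mul_left ?_ _
      exact (ENNReal.ofReal_le_ofReal hV).trans_eq ENNReal.ofReal_coe_nnreal
    have hβE : ENNReal.ofReal (β * ((∑ i, e i ^ 2) / n)) ≤ M * (B * m) := by
      rw [ENNReal.ofReal_mul hβ0, ← hBdef, mul_left_comm]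
      exact mul_le_mul_right hEm _
    rw [ENNReal.ofReal_mul (by norm_num), ENNReal.ofReal_add (by positivity) (by positivity),
      ENNReal.ofReal_add (by positivity) (by positivity),
      ENNReal.ofReal_add (by positivity) (by positivity), ENNReal.ofReal_ofNat]
    have g1 := (mul_le_mul_right hU 256).trans_eq (by push_cast; ring) |>.trans
      (cast_le _ hcC ((K : ℝ≥0∞) / n))
    have g2 := (mul_le_mul_right hEz 256).trans_eq (by push_cast; ring) |>.trans
      (cast_le _ hcM (η / n))
    have g3 := (mul_le_mul_right hβE 256).trans_eq (by push_cast; ring) |>.trans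
      (cast_le _ hcM (B * m))
    have g4 := (mul_le_mul_right hβV 256).trans_eq (by push_cast; ring) |>.trans
      (cast_le _ hcV B)
    rw [mul_add, mul_add, mul_add]
    refine (add_le_add (add_le_add (add_le_add g1 g2) g3) g4).trans_eq ?_
    ring

end GoodSample

end SeriesLS

/-! ### Stochastic bounds and the rates -/

/-- The regression function is the projection of `Y` on the functions of `W`. -/
lemma MeasureTheory.integral_mul_comp_eq_of_condExp {Ω X : Type*} [mΩ : MeasurableSpace Ω]
    [mX : MeasurableSpace X] {μ : Measure Ω} [IsProbabilityMeasure μ] {Y : Ω → ℝ} {W : Ω → X}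
    (hW : Measurable W) (hY : MemLp Y 2 μ) {ψ : X → ℝ}
    (hψY : (fun ω => ψ (W ω)) =ᵐ[μ] μ[Y | MeasurableSpace.comap W mX]) {g : X → ℝ}
    (hg : Measurable g) (hg2 : MemLp (fun ω => g (W ω)) 2 μ) :
    ∫ ω, Y ω * g (W ω) ∂μ = ∫ ω, ψ (W ω) * g (W ω) ∂μ := by
  have hgm : StronglyMeasurable[MeasurableSpace.comap W mX] fun ω => g (W ω) :=
    (hg.comp (comap_measurable W)).stronglyMeasurable
  rw [← integral_condExp hW.comap_le]
  refine integral_congr_ae ?_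
  filter_upwards [condExp_mul_of_stronglyMeasurable_right hgm (hY.integrable_mul hg2)
    (hY.integrable one_le_two), hψY] with ω h1 h2
  refine h1.trans ?_
  rw [Pi.mul_apply, ← h2]

namespace SeriesLS

section

variable {d n K : ℕ} {F : Measure (EuclideanSpace ℝ (Fin d))}
  {q : EuclideanSpace ℝ (Fin d) → EuclideanSpace ℝ (Fin K)}

/-- The Frobenius norm of the whitened generated design. -/
lemma sum_norm_whiten_sq_le (hn : 0 < n) (w x : Fin n → EuclideanSpace ℝ (Fin d)) :
    ∑ i, ‖whiten F q (x i)‖ ^ 2 ≤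
      2 * ∑ i, ‖whiten F q (w i)‖ ^ 2 + 2 * (n * K * Bn F q w x) := by
  have h1 : ∑ i, ‖whiten F q (w i) - whiten F q (x i)‖ ^ 2 ≤ n * K * Bn F q w x := by
    have h2 : ∀ v : EuclideanSpace ℝ (Fin K),
        ‖v‖ ^ 2 = ∑ k, inner ℝ v (EuclideanSpace.single k (1 : ℝ)) ^ 2 := fun v => by
      rw [EuclideanSpace.real_norm_sq_eq]
      simp [EuclideanSpace.inner_single_right]
    simp only [h2 (whiten F q _ - _)]
    rw [Finset.sum_comm]
    refine (Finset.sum_le_sum fun k _ =>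
      sum_inner_whiten_sub_sq_le hn w x (EuclideanSpace.single k (1 : ℝ))).trans_eq ?_
    simp
    ring
  have h3 : ∀ i, ‖whiten F q (x i)‖ ^ 2 ≤
      2 * ‖whiten F q (w i)‖ ^ 2 + 2 * ‖whiten F q (w i) - whiten F q (x i)‖ ^ 2 := fun i => by
    have h := norm_sub_le (whiten F q (w i)) (whiten F q (w i) - whiten F q (x i))
    rw [sub_sub_cancel] at h
    have := pow_le_pow_left₀ (norm_nonneg _) h 2
    nlinarith [sq_nonneg (‖whiten F q (w i)‖ - ‖whiten F q (w i) - whiten F q (x i)‖)]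
  refine (Finset.sum_le_sum fun i _ => h3 i).trans ?_
  rw [Finset.sum_add_distrib, ← Finset.mul_sum, ← Finset.mul_sum]
  linarith

/-- Off an exceptional event whose probability is controlled by that of a degenerate sample Gram
matrix, that of a large perturbation, and `4 / M`, both rates hold with a constant that depends
on `M`, `C` and `V` only. -/
lemma exists_measure_le_forall_sqL2_le {Ω : Type*} {ℱ : MeasurableSpace Ω}
    [mΩ : MeasurableSpace Ω] {μ : Measure Ω} [IsProbabilityMeasure μ] (hn : 0 < n)
    {Y : ℕ → Ω → ℝ} {W : ℕ → Ω → EuclideanSpace ℝ (Fin d)} (hW : ∀ i, Measurable (W i))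
    (hind : iIndepFun W μ) (hF : ∀ i, μ.map (W i) = F)
    (hq : Measurable q) (hq2 : MemLp q 2 F) (hpos : 0 < lambdaMin (gram F q))
    {ψ : EuclideanSpace ℝ (Fin d) → ℝ} (hψ : Measurable ψ)
    (hu2 : ∀ i, MemLp (fun ω => Y i ω - ψ (W i ω)) 2 μ)
    {What : Fin n → Ω → EuclideanSpace ℝ (Fin d)} (hℱ : ℱ ≤ mΩ)
    (hWhat : ∀ i, Measurable[ℱ] (What i)) {C : ℝ≥0}
    (hvar : ∀ i : Fin n, μ[fun ω => (Y i ω - ψ (W i ω)) ^ 2 | ℱ] ≤ᵐ[μ] fun _ => (C : ℝ))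
    (hcov : ∀ i j : Fin n, i ≠ j →
      μ[fun ω => (Y i ω - ψ (W i ω)) * (Y j ω - ψ (W j ω)) | ℱ] =ᵐ[μ] 0)
    {b : EuclideanSpace ℝ (Fin K)} {bhat : Ω → EuclideanSpace ℝ (Fin K)}
    (hbhat : ∀ᵐ ω ∂μ,
      IsMinOn (lsLoss q (fun i : Fin n => Y i ω) (fun i => What i ω)) Set.univ (bhat ω))
    (hortho : ∀ k, ∫ w, (ψ w - lin q b w) * whiten F q w k ∂F = 0)
    {V : ℝ≥0} (hV : ‖whitenCoef F q b‖ ^ 2 ≤ V) {ϑ : ℝ≥0∞}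
    (hϑW : ∀ i, ∀ᵐ ω ∂μ, ‖ψ (W i ω) - lin q b (W i ω)‖ₑ ≤ ϑ)
    (hϑWhat : ∀ i, ∀ᵐ ω ∂μ, ‖ψ (What i ω) - lin q b (What i ω)‖ₑ ≤ ϑ)
    {η : ℝ≥0∞} (hη : ∫⁻ w, ‖ψ w - lin q b w‖ₑ ^ 2 * ‖whiten F q w‖ₑ ^ 2 ∂F ≤ η)
    {ξ : ℝ≥0∞} (hξ : sqL2 F (fun w => ψ w - lin q b w) = ξ)
    {B m err : Ω → ℝ≥0∞}
    (hB : ∀ ω, B ω = ENNReal.ofReal (Bn F q (fun i : Fin n => W i ω) (fun i => What i ω)))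
    (hm : ∀ ω, m ω = min (B ω + ξ)
      (ENNReal.ofReal (Rn ψ (fun i : Fin n => W i ω) (fun i => What i ω)) + ϑ ^ 2))
    (herr : ∀ ω, err ω = sqL2 F (fun w => lin q (bhat ω) w - lin q b w))
    {M : ℝ≥0} (hM : 1 ≤ M) :
    ∃ N : Set Ω, μ N ≤ μ (lowGram (whiten F q) W n) + μ {ω | ENNReal.ofReal (1 / 16) ≤ B ω} +
        4 * (M : ℝ≥0∞)⁻¹ ∧
      ∀ ω ∉ N,
        err ω ≤ (512 * (M * (C * (2 * M + 1)) + M + V + 1) : ℝ≥0) * ((K : ℝ≥0∞) / n + m ω) ∧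
        err ω ≤ (512 * (M * (C * (2 * M + 1)) + M + V + 1) : ℝ≥0) *
          ((K : ℝ≥0∞) / n + (B ω + B ω * m ω + η / n)) := by
  have hM0 : M ≠ 0 := (zero_lt_one.trans_le hM).ne'
  set z := whiten F q
  have hz : Measurable z := measurable_whiten hq
  set e : EuclideanSpace ℝ (Fin d) → ℝ := fun w => ψ w - lin q b w
  have he : Measurable e := hψ.sub (measurable_lin hq b)
  set N₀ := lowGram z W n
  set N₁ := {ω | ENNReal.ofReal (1 / 16) ≤ B ω}
  set f₂ : Ω → ℝ≥0∞ := fun ω => ∑ i : Fin n, ‖z (W i ω)‖ₑ ^ 2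
  set N₂ := {ω | (M : ℝ≥0∞) * (n * K) < f₂ ω} with hN₂
  -- a bound on `∑ ‖z (What i)‖²` that holds off `N₁` and `N₂`, since `2 / 16 ≤ 1`
  set τ : ℝ := (2 * M + 1) * (n * K) with hτ
  set A := {ω | ∑ i, ‖z (What i ω)‖ ^ 2 ≤ τ}
  set f₃ : Ω → ℝ≥0∞ :=
    A.indicator fun ω => ‖∑ i : Fin n, (Y i ω - ψ (W i ω)) • z (What i ω)‖ₑ ^ 2
  set N₃ := {ω | (M : ℝ≥0∞) * ENNReal.ofReal (C * τ) < f₃ ω} with hN₃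
  set f₄ : Ω → ℝ≥0∞ := fun ω => ∑ i : Fin n, ‖e (W i ω)‖ₑ ^ 2
  set N₄ := {ω | (M : ℝ≥0∞) * (n * ξ) < f₄ ω} with hN₄
  set f₅ : Ω → ℝ≥0∞ := fun ω => ‖∑ i : Fin n, e (W i ω) • z (W i ω)‖ₑ ^ 2
  set N₅ := {ω | (M : ℝ≥0∞) * (n * η) < f₅ ω} with hN₅
  have hsum : ∀ g : EuclideanSpace ℝ (Fin d) → ℝ≥0∞, Measurable g →
      ∫⁻ ω, ∑ i : Fin n, g (W i ω) ∂μ = n * ∫⁻ w, g w ∂F := fun g hg => by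
    have hgW : ∀ i, Measurable fun ω => g (W i ω) := fun i => hg.comp (hW i)
    rw [lintegral_finsetSum _ fun (i : Fin n) _ => hgW i]
    have h : ∀ i : Fin n, ∫⁻ ω, g (W i ω) ∂μ = ∫⁻ w, g w ∂F := fun i => by
      rw [← hF i, lintegral_map hg (hW i)]
    simp [h]
  have hzm := hz.enorm.pow_const 2
  have hem := he.enorm.pow_const 2
  have hf₂ : Measurable f₂ := Finset.measurable_sum _ fun i _ => hzm.comp (hW i)
  have hf₄ : Measurable f₄ := Finset.measurable_sum _ fun i _ => hem.comp (hW i)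
  have h₂ : μ N₂ ≤ (M : ℝ≥0∞)⁻¹ :=
    measure_mul_lt_le_inv hf₂.aemeasurable
      (by rw [hsum _ hzm, lintegral_enorm_whiten_sq hq2 hpos]) hM0
  have hyℱ : ∀ i, Measurable[ℱ] fun ω => z (What i ω) := fun i => hz.comp (hWhat i)
  have hA : MeasurableSet A := by
    have hN : Measurable fun ω => ∑ i, ‖z (What i ω)‖ ^ 2 :=
      Finset.measurable_sum _ fun i _ => (((hyℱ i).mono hℱ le_rfl).norm.pow_const 2)
    exact hN measurableSet_Iic
  have h₃ : μ N₃ ≤ (M : ℝ≥0∞)⁻¹ := by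
    refine measure_mul_lt_le_inv ?_ ?_ hM0
    · refine AEMeasurable.indicator ?_ hA
      refine (AEMeasurable.enorm ?_).pow_const 2
      refine Finset.aemeasurable_fun_sum _ fun i _ => ?_
      exact (hu2 i).1.aemeasurable.smul ((hyℱ i).mono hℱ le_rfl).aemeasurable
    · rw [lintegral_indicator hA]
      exact setLIntegral_enorm_sum_smul_sq_le hℱ (fun i => hu2 i) hyℱ C.coe_nonneg hvar hcov τ
  have h₄ : μ N₄ ≤ (M : ℝ≥0∞)⁻¹ :=
    measure_mul_lt_le_inv hf₄.aemeasurable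
      (by rw [hsum _ hem]; exact (congrArg _ hξ).le) hM0
  have h₅ : μ N₅ ≤ (M : ℝ≥0∞)⁻¹ := by
    refine measure_mul_lt_le_inv ?_ ?_ hM0
    · refine ((Finset.measurable_sum _ fun i _ => ?_).enorm.pow_const 2).aemeasurable
      exact (he.comp (hW i)).smul (hz.comp (hW i))
    · refine (lintegral_enorm_sum_smul_sq_le hW hind hF he hz hortho n).trans ?_
      exact mul_le_mul_right hη _
  have hae := (hbhat.and ((ae_all_iff.2 hϑW).and (ae_all_iff.2 hϑWhat)))
  set N₆ := {ω | ¬ (IsMinOn (lsLoss q (fun i : Fin n => Y i ω) (fun i => What i ω)) Set.univ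
    (bhat ω) ∧ (∀ i, ‖e (W i ω)‖ₑ ≤ ϑ) ∧ ∀ i, ‖e (What i ω)‖ₑ ≤ ϑ)} with hN₆
  have h₆ : μ N₆ = 0 := ae_iff.1 hae
  refine ⟨N₀ ∪ N₁ ∪ N₂ ∪ N₃ ∪ N₄ ∪ N₅ ∪ N₆, ?_, ?_⟩
  · refine (measure_union_le _ _).trans ?_
    rw [h₆, add_zero]
    refine (measure_union_le _ _).trans ((add_le_add (measure_union_le _ _) h₅).trans ?_)
    refine (add_le_add_left (add_le_add (measure_union_le _ _) h₄) _).trans ?_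
    refine (add_le_add_left (add_le_add_left (add_le_add (measure_union_le _ _) h₃) _) _).trans ?_
    refine (add_le_add_left (add_le_add_left (add_le_add_left
      (add_le_add (measure_union_le _ _) h₂) _) _) _).trans_eq ?_
    ring
  · intro ω hω
    simp only [Set.mem_union, not_or] at hω
    obtain ⟨⟨⟨⟨⟨⟨k0, k1⟩, k2⟩, k3⟩, k4⟩, k5⟩, k6⟩ := hω
    have k2' : f₂ ω ≤ M * (n * K) := not_lt.1 fun h => k2 (by rw [hN₂]; exact h)
    have k3' : f₃ ω ≤ M * ENNReal.ofReal (C * τ) := not_lt.1 fun h => k3 (by rw [hN₃]; exact h)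
    have k4' : f₄ ω ≤ M * (n * ξ) := not_lt.1 fun h => k4 (by rw [hN₄]; exact h)
    have k5' : f₅ ω ≤ M * (n * η) := not_lt.1 fun h => k5 (by rw [hN₅]; exact h)
    have k6' : IsMinOn (lsLoss q (fun i : Fin n => Y i ω) (fun i => What i ω)) Set.univ
        (bhat ω) ∧ (∀ i, ‖e (W i ω)‖ₑ ≤ ϑ) ∧ ∀ i, ‖e (What i ω)‖ₑ ≤ ϑ :=
      not_not.1 fun h => k6 (by rw [hN₆]; exact h)
    obtain ⟨hmin, hθ1, hθ2⟩ := k6'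
    have hBω : Bn F q (fun i : Fin n => W i ω) (fun i => What i ω) ≤ 1 / 16 := by
      by_contra hlt
      refine k1 ?_
      change ENNReal.ofReal (1 / 16) ≤ B ω
      rw [hB]
      exact ENNReal.ofReal_le_ofReal (not_le.1 hlt).le
    have hgram : ∀ v, n / 2 * ‖v‖ ^ 2 ≤ ∑ i : Fin n, inner ℝ (z (W i ω)) v ^ 2 := fun v =>
      not_lt.1 fun h => k0 ⟨v, h⟩
    have hsq : ∀ r : ℝ, ‖r‖ₑ ^ 2 = ENNReal.ofReal (r ^ 2) := fun r => by
      rw [← enorm_pow, Real.enorm_of_nonneg (sq_nonneg r)]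
    have hsq' : ∀ v : EuclideanSpace ℝ (Fin K), ‖v‖ₑ ^ 2 = ENNReal.ofReal (‖v‖ ^ 2) := fun v => by
      rw [ENNReal.ofReal_pow (norm_nonneg _), ofReal_norm]
    have hZ : ∑ i : Fin n, ‖z (W i ω)‖ ^ 2 ≤ M * (n * K) := by
      have h : f₂ ω = ENNReal.ofReal (∑ i : Fin n, ‖z (W i ω)‖ ^ 2) := by
        rw [ENNReal.ofReal_sum_of_nonneg fun _ _ => sq_nonneg _]
        exact Finset.sum_congr rfl fun i _ => hsq' _
      have h' : (M : ℝ≥0∞) * (n * K) = ENNReal.ofReal (M * (n * K)) := by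
        rw [ENNReal.ofReal_mul M.coe_nonneg, ENNReal.ofReal_mul (Nat.cast_nonneg n),
          ENNReal.ofReal_natCast, ENNReal.ofReal_natCast, ENNReal.ofReal_coe_nnreal]
      rw [h, h', ENNReal.ofReal_le_ofReal_iff (by positivity)] at k2'
      exact k2'
    have hmemA : ω ∈ A := by
      change ∑ i, ‖z (What i ω)‖ ^ 2 ≤ τ
      have h := sum_norm_whiten_sq_le (F := F) (q := q) hn (fun i : Fin n => W i ω)
        (fun i => What i ω)
      have h' : (n * K : ℝ) * Bn F q (fun i : Fin n => W i ω) (fun i => What i ω) ≤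
          n * K * (1 / 16) := by gcongr
      have : (0 : ℝ) ≤ n * K := by positivity
      rw [hτ]
      linarith
    have hu : ‖∑ i : Fin n, (Y i ω - ψ (W i ω)) • z (What i ω)‖ ^ 2 ≤
        (M * (C * (2 * M + 1)) : ℝ≥0) * (n * K) := by
      have h : f₃ ω = ENNReal.ofReal
          (‖∑ i : Fin n, (Y i ω - ψ (W i ω)) • z (What i ω)‖ ^ 2) := by
        rw [← hsq']; exact Set.indicator_of_mem hmemA _
      have h' : (M : ℝ≥0∞) * ENNReal.ofReal (C * τ) = ENNReal.ofReal (M * (C * τ)) := by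
        rw [ENNReal.ofReal_mul M.coe_nonneg, ENNReal.ofReal_coe_nnreal]
      rw [h, h', ENNReal.ofReal_le_ofReal_iff (by positivity)] at k3'
      refine k3'.trans_eq ?_
      rw [hτ]; push_cast; ring
    have hE : ENNReal.ofReal (∑ i : Fin n, (ψ (W i ω) - lin q b (W i ω)) ^ 2) ≤ M * (n * ξ) := by
      refine le_trans (le_of_eq ?_) k4'
      rw [ENNReal.ofReal_sum_of_nonneg fun _ _ => sq_nonneg _]
      exact Finset.sum_congr rfl fun i _ => (hsq _).symm
    have hEZ : ENNReal.ofReal (‖∑ i : Fin n, (ψ (W i ω) - lin q b (W i ω)) • z (W i ω)‖ ^ 2) ≤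
        M * (n * η) := by
      rw [← hsq']; exact k5'
    rw [herr]
    exact sqL2_lin_sub_lin_le hn hq2 hpos hmin hgram hBω hM hV hu hE hEZ (fun i => hθ1 i) hθ2
      (hB ω) (hm ω)

end

end SeriesLS

namespace SeriesLS

section Population

variable {Ω : Type*} [MeasurableSpace Ω] {μ : Measure Ω} {d K : ℕ}
  {Y : Ω → ℝ} {W : Ω → EuclideanSpace ℝ (Fin d)} {ψ : EuclideanSpace ℝ (Fin d) → ℝ}
  {q : EuclideanSpace ℝ (Fin d) → EuclideanSpace ℝ (Fin K)} {b : EuclideanSpace ℝ (Fin K)}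

/-- The approximation error of the best linear approximation of `Y` is orthogonal to the basis. -/
lemma integral_sub_lin_mul_whiten_eq_zero [IsProbabilityMeasure μ] (hW : Measurable W) (hY : MemLp Y 2 μ)
    (hψ : Measurable ψ) (hψ2 : MemLp (fun ω => ψ (W ω)) 2 μ)
    (hψY : (fun ω => ψ (W ω)) =ᵐ[μ] μ[Y | MeasurableSpace.comap W inferInstance])
    (hq : Measurable q) (hq2 : MemLp q 2 (μ.map W))
    (hb : IsMinOn (fun b => ∫ ω, (Y ω - lin q b (W ω)) ^ 2 ∂μ) Set.univ b) (k : Fin K) :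
    ∫ w, (ψ w - lin q b w) * whiten (μ.map W) q w k ∂(μ.map W) = 0 := by
  have hlin : ∀ c, MemLp (fun ω => lin q c (W ω)) 2 μ := fun c =>
    (memLp_lin hq2 c).comp_of_map hW.aemeasurable
  set c : EuclideanSpace ℝ (Fin K) := WithLp.toLp 2 fun j => invSqrt (gram (μ.map W) q) j k
  have hc : ∀ w, whiten (μ.map W) q w k = lin q c w := fun w => rfl
  have hm := ((hψ.sub (measurable_lin hq b)).mul (measurable_lin hq c)).aestronglyMeasurable
    (μ := μ.map W)
  simp only [hc]
  refine (integral_map hW.aemeasurable hm).trans ?_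
  have h1 := integral_mul_lin_eq_zero hY hlin hb c
  have h2 := integral_mul_comp_eq_of_condExp hW hY hψY (measurable_lin hq c) (hlin c)
  simp only [Pi.mul_apply, Pi.sub_apply, sub_mul] at h1 ⊢
  have i1 : Integrable (fun ω => Y ω * lin q c (W ω)) μ := hY.integrable_mul (hlin c)
  have i2 : Integrable (fun ω => lin q b (W ω) * lin q c (W ω)) μ :=
    (hlin b).integrable_mul (hlin c)
  have i3 : Integrable (fun ω => ψ (W ω) * lin q c (W ω)) μ := hψ2.integrable_mul (hlin c)
  rw [integral_sub i1 i2] at h1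
  rw [integral_sub i3 i2, ← h2]
  exact h1

/-- The coefficients of the best linear approximation are bounded by the second moment of `Y`. -/
lemma norm_whitenCoef_sq_le (hW : Measurable W) (hY : MemLp Y 2 μ) (hq : Measurable q)
    (hq2 : MemLp q 2 (μ.map W)) (hpos : 0 < lambdaMin (gram (μ.map W) q))
    (hb : IsMinOn (fun b => ∫ ω, (Y ω - lin q b (W ω)) ^ 2 ∂μ) Set.univ b) :
    ‖whitenCoef (μ.map W) q b‖ ^ 2 ≤ ∫ ω, Y ω ^ 2 ∂μ := by
  have hlin : ∀ c, MemLp (fun ω => lin q c (W ω)) 2 μ := fun c =>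
    (memLp_lin hq2 c).comp_of_map hW.aemeasurable
  rw [← integral_inner_whiten_sq hq2 hpos]
  simp only [inner_whiten_whitenCoef hpos]
  rw [integral_map hW.aemeasurable ((measurable_lin hq b).pow_const 2).aestronglyMeasurable]
  have h1 := integral_mul_lin_eq_zero hY hlin hb b
  have i1 : Integrable (fun ω => lin q b (W ω) ^ 2) μ := (hlin b).integrable_sq
  have i2 : Integrable (fun ω => (Y ω - lin q b (W ω)) * lin q b (W ω)) μ :=
    (hY.sub (hlin b)).integrable_mul (hlin b)
  calc ∫ ω, lin q b (W ω) ^ 2 ∂μ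
      = ∫ ω, (lin q b (W ω) ^ 2 + 2 * ((Y ω - lin q b (W ω)) * lin q b (W ω))) ∂μ := by
        rw [integral_add i1 (i2.const_mul 2), integral_const_mul, h1]; ring
    _ ≤ ∫ ω, Y ω ^ 2 ∂μ := by
        refine integral_mono (i1.add (i2.const_mul 2)) hY.integrable_sq fun ω => ?_
        nlinarith [sq_nonneg (Y ω - lin q b (W ω))]

/-- The two bounds on the second moment of the whitened basis weighted by an approximation error,
according to which factor is bounded pointwise. -/
lemma lintegral_enorm_sq_mul_whiten_le {F : Measure (EuclideanSpace ℝ (Fin d))}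
    {e : EuclideanSpace ℝ (Fin d) → ℝ} (he : Measurable e) (hq : Measurable q)
    (hq2 : MemLp q 2 F) (hpos : 0 < lambdaMin (gram F q)) {L ϑ : ℝ≥0∞}
    (hL : ∀ᵐ w ∂F, ‖whiten F q w‖ₑ ^ 2 ≤ L) (hϑ : ∀ᵐ w ∂F, ‖e w‖ₑ ≤ ϑ) :
    ∫⁻ w, ‖e w‖ₑ ^ 2 * ‖whiten F q w‖ₑ ^ 2 ∂F ≤ min (L * sqL2 F e) (K * ϑ ^ 2) := by
  refine le_min ?_ ?_
  · rw [sqL2, ← lintegral_const_mul _ (he.enorm.pow_const 2)]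
    refine lintegral_mono_ae ?_
    filter_upwards [hL] with w hw
    rw [mul_comm]
    exact mul_le_mul_left hw _
  · rw [← lintegral_enorm_whiten_sq hq2 hpos, mul_comm,
      ← lintegral_const_mul _ ((measurable_whiten hq).enorm.pow_const 2)]
    refine lintegral_mono_ae ?_
    filter_upwards [hϑ] with w hw
    exact mul_le_mul_left (pow_le_pow_left' hw 2) _

lemma enorm_whiten_sq_le {F : Measure (EuclideanSpace ℝ (Fin d))}
    (hpos : 0 < lambdaMin (gram F q)) {ζ : ℝ≥0∞} {w : EuclideanSpace ℝ (Fin d)} (hζ : ‖q w‖ₑ ≤ ζ) :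
    ‖whiten F q w‖ₑ ^ 2 ≤ (ENNReal.ofReal (lambdaMin (gram F q)))⁻¹ * ζ ^ 2 := by
  have hsq : ∀ v : EuclideanSpace ℝ (Fin K), ‖v‖ₑ ^ 2 = ENNReal.ofReal (‖v‖ ^ 2) := fun v => by
    rw [ENNReal.ofReal_pow (norm_nonneg _), ofReal_norm]
  rw [hsq]
  refine (ENNReal.ofReal_le_ofReal (norm_whiten_sq_le hpos w)).trans ?_
  rw [ENNReal.ofReal_mul (inv_nonneg.2 hpos.le), ENNReal.ofReal_inv_of_pos hpos, ← hsq]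
  exact mul_le_mul_right (pow_le_pow_left' hζ 2) _

end Population

/-- An almost sure membership in `S` of `W` carries bounds on `S` over to the law of `W`, even if
`S` is not measurable. -/
lemma ae_map_enorm_le_of_mem {Ω X E : Type*} [MeasurableSpace Ω] [MeasurableSpace X]
    [SeminormedAddGroup E] [MeasurableSpace E] [OpensMeasurableSpace E] {μ : Measure Ω} {W : Ω → X}
    (hW : Measurable W) {S : Set X} (hS : ∀ᵐ ω ∂μ, W ω ∈ S) {g : X → E} (hg : Measurable g) :
    ∀ᵐ x ∂(μ.map W), ‖g x‖ₑ ≤ ⨆ x ∈ S, ‖g x‖ₑ := by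
  rw [ae_map_iff hW.aemeasurable (measurableSet_le hg.enorm measurable_const)]
  filter_upwards [hS] with ω h
  exact le_iSup₂ (f := fun x (_ : x ∈ S) => ‖g x‖ₑ) (W ω) h

end SeriesLS

open SeriesLS in
theorem theorem2
    {Ω : Type*} [mΩ : MeasurableSpace Ω] (μ : Measure Ω) [IsProbabilityMeasure μ]
    {d : ℕ} (S : Set (EuclideanSpace ℝ (Fin d)))
    -- the data, an i.i.d. sequence with covariates in `S`
    (Y : ℕ → Ω → ℝ) (W : ℕ → Ω → EuclideanSpace ℝ (Fin d))
    (hY : ∀ i, Measurable (Y i)) (hW : ∀ i, Measurable (W i))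
    (hindep : iIndepFun (fun i ω => (Y i ω, W i ω)) μ)
    (hident : ∀ i, IdentDistrib (fun ω => (Y i ω, W i ω)) (fun ω => (Y 0 ω, W 0 ω)) μ μ)
    (hWS : ∀ i, ∀ᵐ ω ∂μ, W i ω ∈ S)
    (hY2 : MemLp (Y 0) 2 μ)
    -- the regression function `ψ(w) = E[Y | W = w]`
    (ψ : EuclideanSpace ℝ (Fin d) → ℝ) (hψ : Measurable ψ)
    (hψY : (fun ω => ψ (W 0 ω)) =ᵐ[μ] μ[Y 0 | MeasurableSpace.comap (W 0) inferInstance])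
    -- the basis functions `p_K`, the number `K = K_n` of them used, the Gram matrix
    (p : (K : ℕ) → EuclideanSpace ℝ (Fin d) → EuclideanSpace ℝ (Fin K))
    (hp : ∀ K, Measurable (p K))
    (K : ℕ → ℕ) (hK : ∀ n, 1 ≤ K n)
    (hp2 : ∀ n, MemLp (p (K n)) 2 (μ.map (W 0)))
    (hlam : ∀ n, 0 < SeriesLS.lambdaMin (SeriesLS.gram (μ.map (W 0)) (p (K n))))
    -- the generated covariates and the sigma fields
    (What : (n : ℕ) → Fin n → Ω → EuclideanSpace ℝ (Fin d))
    (hWhatS : ∀ n i, ∀ᵐ ω ∂μ, What n i ω ∈ S)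
    (ℱ : ℕ → MeasurableSpace Ω) (hℱ : ∀ n, ℱ n ≤ mΩ)
    (hWhat : ∀ n i, Measurable[ℱ n] (What n i))
    (hvar : ∃ C : ℝ, ∀ n, ∀ i : Fin n,
      μ[fun ω => (Y i ω - ψ (W i ω)) ^ 2 | ℱ n] ≤ᵐ[μ] fun _ => C)
    (hcov : ∀ n, ∀ i j : Fin n, i ≠ j →
      μ[fun ω => (Y i ω - ψ (W i ω)) * (Y j ω - ψ (W j ω)) | ℱ n] =ᵐ[μ] 0)
    -- the population and the sample least squares coefficients
    (β : (n : ℕ) → EuclideanSpace ℝ (Fin (K n)))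
    (hβ : ∀ n, IsMinOn (fun b => ∫ ω, (Y 0 ω - SeriesLS.lin (p (K n)) b (W 0 ω)) ^ 2 ∂μ)
      Set.univ (β n))
    (βhat : (n : ℕ) → Ω → EuclideanSpace ℝ (Fin (K n)))
    (hβhat : ∀ n, ∀ᵐ ω ∂μ,
      IsMinOn (SeriesLS.lsLoss (p (K n)) (fun i : Fin n => Y i ω) (fun i => What n i ω))
        Set.univ (βhat n ω))
    -- abbreviations for the quantities in the rates
    (F : Measure (EuclideanSpace ℝ (Fin d))) (hF : F = μ.map (W 0))
    (lam : ℕ → ℝ≥0∞)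
    (hlam_def : ∀ n, lam n =
      ENNReal.ofReal (SeriesLS.lambdaMin (SeriesLS.gram F (p (K n)))))
    (ζ : ℕ → ℝ≥0∞) (hζ : ∀ n, ζ n = SeriesLS.zetaZero S (p (K n)))
    (ξsq : ℕ → ℝ≥0∞)
    (hξsq : ∀ n, ξsq n = SeriesLS.sqL2 F (fun w => ψ w - SeriesLS.lin (p (K n)) (β n) w))
    (ϑ : ℕ → ℝ≥0∞)
    (hϑ : ∀ n, ϑ n = SeriesLS.supNorm S (fun w => ψ w - SeriesLS.lin (p (K n)) (β n) w))
    (R B : ℕ → Ω → ℝ)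
    (hR : ∀ n ω, R n ω = SeriesLS.Rn ψ (fun i : Fin n => W i ω) (fun i => What n i ω))
    (hB : ∀ n ω, B n ω =
      SeriesLS.Bn F (p (K n)) (fun i : Fin n => W i ω) (fun i => What n i ω))
    -- the `L²` error and the common minimum in the two approximation terms
    (err m : ℕ → Ω → ℝ≥0∞)
    (herr : ∀ n ω, err n ω = SeriesLS.sqL2 F
      (fun w => SeriesLS.lin (p (K n)) (βhat n ω) w - SeriesLS.lin (p (K n)) (β n) w))
    (hm : ∀ n ω, m n ω =
      min (ENNReal.ofReal (B n ω) + ξsq n) (ENNReal.ofReal (R n ω) + ϑ n ^ 2))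
    -- the rate conditions
    (hrate : Tendsto
      (fun n : ℕ => (lam n)⁻¹ * ζ n ^ 2 * ENNReal.ofReal (Real.log (K n)) / (n : ℝ≥0∞))
      atTop (𝓝 0))
    (hBlim : TendstoInMeasure μ B atTop (fun _ => 0)) :
    SeriesLS.IsBigOP μ err (fun n ω => (K n : ℝ≥0∞) / n + m n ω) ∧
    SeriesLS.IsBigOP μ err (fun n ω => (K n : ℝ≥0∞) / n +
      (ENNReal.ofReal (B n ω) + ENNReal.ofReal (B n ω) * m n ω +
        min ((lam n)⁻¹ * ζ n ^ 2 * ξsq n / n) ((K n : ℝ≥0∞) * ϑ n ^ 2 / n))) := by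
  subst hF
  -- the laws of the data
  have hind : iIndepFun W μ := hindep.comp (fun _ => Prod.snd) fun _ => measurable_snd
  have hmap : ∀ i, μ.map (W i) = μ.map (W 0) := fun i => ((hident i).comp measurable_snd).map_eq
  have hYi : ∀ i, MemLp (Y i) 2 μ := fun i =>
    ((hident i).comp measurable_fst).symm.memLp_snd hY2
  have hψ0 : MemLp (fun ω => ψ (W 0 ω)) 2 μ := (hY2.condExp one_le_two).ae_eq hψY.symm
  have hψF : MemLp ψ 2 (μ.map (W 0)) :=
    (memLp_map_measure_iff hψ.aestronglyMeasurable (hW 0).aemeasurable).2 hψ0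
  have hu2 : ∀ i, MemLp (fun ω => Y i ω - ψ (W i ω)) 2 μ := fun i =>
    (hYi i).sub ((hmap i ▸ hψF).comp_of_map (hW i).aemeasurable)
  set F := μ.map (W 0)
  obtain ⟨C, hC⟩ := hvar
  set C' : ℝ≥0 := C.toNNReal
  set V : ℝ≥0 := (∫ ω, Y 0 ω ^ 2 ∂μ).toNNReal
  have hL : ∀ n, ∀ᵐ w ∂F, ‖whiten F (p (K n)) w‖ₑ ^ 2 ≤ (lam n)⁻¹ * ζ n ^ 2 := fun n => by
    filter_upwards [ae_map_enorm_le_of_mem (hW 0) (hWS 0) (hp (K n))] with w hw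
    rw [hlam_def, hζ]
    exact enorm_whiten_sq_le (hlam n) hw
  have he : ∀ n, Measurable fun w => ψ w - lin (p (K n)) (β n) w := fun n =>
    hψ.sub (measurable_lin (hp _) _)
  have hϑS : ∀ n, ∀ x ∈ S, ‖ψ x - lin (p (K n)) (β n) x‖ₑ ≤ ϑ n := fun n x hx => by
    rw [hϑ]
    exact le_iSup₂ (f := fun x (_ : x ∈ S) => ‖ψ x - lin (p (K n)) (β n) x‖ₑ) x hx
  have hη : ∀ n, ∫⁻ w, ‖ψ w - lin (p (K n)) (β n) w‖ₑ ^ 2 * ‖whiten F (p (K n)) w‖ₑ ^ 2 ∂F ≤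
      min ((lam n)⁻¹ * ζ n ^ 2 * ξsq n) (K n * ϑ n ^ 2) := fun n => by
    rw [hξsq, hϑ]
    exact lintegral_enorm_sq_mul_whiten_le (he n) (hp _) (hp2 n) (hlam n) (hL n)
      (ae_map_enorm_le_of_mem (hW 0) (hWS 0) (he n))
  have hgram := tendsto_measure_lowGram hW hind hmap hp hK hp2 hlam hL hrate
  have hBsmall : Tendsto (fun n => μ {ω | ENNReal.ofReal (1 / 16) ≤ ENNReal.ofReal (B n ω)})
      atTop (𝓝 0) := by
    have h := hBlim (ENNReal.ofReal (1 / 16)) (by simp)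
    have e : ∀ n ω, edist (B n ω) 0 = ENNReal.ofReal (B n ω) := fun n ω => by
      rw [edist_dist, Real.dist_eq, sub_zero, abs_of_nonneg (by rw [hB]; exact Bn_nonneg _ _)]
    simpa only [e] using h
  -- both rates hold with the same constant off the same exceptional event
  have key : ∀ ε : ℝ≥0∞, 0 < ε → ∃ c : ℝ≥0, ∀ᶠ n : ℕ in atTop, ∃ N : Set Ω, μ N ≤ ε ∧ ∀ ω ∉ N,
      err n ω ≤ c * ((K n : ℝ≥0∞) / n + m n ω) ∧
      err n ω ≤ c * ((K n : ℝ≥0∞) / n +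
        (ENNReal.ofReal (B n ω) + ENNReal.ofReal (B n ω) * m n ω +
          min ((lam n)⁻¹ * ζ n ^ 2 * ξsq n / n) ((K n : ℝ≥0∞) * ϑ n ^ 2 / n))) := by
    intro ε hε
    have hε3 : 0 < ε / 3 := ENNReal.div_pos hε.ne' (by simp)
    obtain ⟨M, hM⟩ := ENNReal.exists_nat_mul_gt hε3.ne' (by simp : (4 : ℝ≥0∞) ≠ ∞)
    have hM0 : M ≠ 0 := by rintro rfl; simp at hM
    have hM1 : (1 : ℝ≥0) ≤ M := by exact_mod_cast Nat.one_le_iff_ne_zero.2 hM0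
    have hM4 : 4 * ((M : ℝ≥0) : ℝ≥0∞)⁻¹ ≤ ε / 3 := by
      rw [← div_eq_mul_inv]
      exact ENNReal.div_le_of_le_mul' (by simpa using hM.le)
    refine ⟨512 * (M * (C' * (2 * M + 1)) + M + V + 1), ?_⟩
    filter_upwards [eventually_gt_atTop 0, ENNReal.tendsto_nhds_zero.1 hgram _ hε3,
      ENNReal.tendsto_nhds_zero.1 hBsmall _ hε3] with n hn h1 h2
    obtain ⟨N, hN, hbound⟩ := exists_measure_le_forall_sqL2_le (C := C') (V := V) (M := M)
      (ϑ := ϑ n) (ξ := ξsq n) (B := fun ω => ENNReal.ofReal (B n ω)) (m := m n) (err := err n)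
      hn hW hind hmap (hp _) (hp2 n) (hlam n) hψ hu2 (hℱ n) (hWhat n)
      (fun i => (hC n i).trans (ae_of_all _ fun _ => Real.le_coe_toNNReal C)) (hcov n) (hβhat n)
      (integral_sub_lin_mul_whiten_eq_zero (hW 0) hY2 hψ hψ0 hψY (hp _) (hp2 n) (hβ n))
      ((norm_whitenCoef_sq_le (hW 0) hY2 (hp _) (hp2 n) (hlam n) (hβ n)).trans
        (Real.le_coe_toNNReal _))
      (fun i => (hWS i).mono fun ω h => hϑS n _ h) (fun i => (hWhatS n i).mono fun ω h => hϑS n _ h)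
      (hη n) (hξsq n).symm (fun ω => by rw [hB]) (fun ω => by rw [hm, hR]) (herr n) hM1
    refine ⟨N, hN.trans ?_, fun ω hω => ⟨(hbound ω hω).1, (hbound ω hω).2.trans ?_⟩⟩
    · refine (add_le_add (add_le_add h1 h2) hM4).trans_eq ?_
      exact ENNReal.add_thirds ε
    · gcongr
      exact le_min (ENNReal.div_le_div_right (min_le_left _ _) _)
        (ENNReal.div_le_div_right (min_le_right _ _) _)
  constructor <;> intro ε hε <;> obtain ⟨c, hc⟩ := key ε hε <;> refine ⟨c, hc.mono ?_⟩ <;>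
    rintro n ⟨N, hN, hbound⟩ <;> refine (measure_mono fun ω hω => ?_).trans hN <;>
    by_contra hωN
  · exact absurd (hbound ω hωN).1 (not_le.2 hω)
  · exact absurd (hbound ω hωN).2 (not_le.2 hω)
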